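/- For a set $O$ let $\mathbf N/O$ be the category whose objects are the finite sequences of elements of $O$ (mappings $\alpha:\{1,\dots,n\}\to O$, $n\ge 0$) and whose arrows $\alpha\to\beta$ are the mappings $p$ of index sets with $\beta p=\alpha$. An *fp-structure* on a multicategory $\mathbf M$ is a functorial action of $\mathbf N/\mathrm{obj}\,\mathbf M$ on the hom-sets, $p:\mathbf M(\alpha;X)\to\mathbf M(\beta;X)$ for $p:\alpha\to\beta$, such that $$f(p_1f_1,\dots,p_nf_n)=(p_1+\cdots+p_n)\,f(f_1,\dots,f_n),\qquad (pf)(f_1,\dots,f_m)=p'\bigl(f(f_{p1},\dots,f_{pn})\bigr),$$ where $p'$ maps the $i$-th block identically onto the $p(i)$-th block. A *cartesian multicategory* is a multicategory with an fp-structure, and an *fp-functor* is a functor of multicategories that commutes with the actions. A *representation* of $\mathbf M$ assigns to each finite sequence $s$ of objects an object $\otimes s$ and an arrow $\eta_s:s\to\otimes s$, such that for all finite sequences $t_1,\dots,t_n$ of objects, and every object $Z$, each arrow from the concatenation of $t_1,\dots,t_n$ to $Z$ is $f(\eta_{t_1},\dots,\eta_{t_n})$ for a unique $f\in\mathbf M(\otimes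 t_1,\dots,\otimes t_n;Z)$; $\mathbf M$ is *representable* if it has a representation. Let $\mathrm{Cat}^\times$ be the category of categories with finite products and finite product preserving functors, and $\mathrm{fpRep}$ the category of cartesian multicategories whose underlying multicategory is representable, with all fp-functors. For $\mathcal C\in\mathrm{Cat}^\times$ let $\mathcal C_\times$ be the cartesian multicategory with the objects of $\mathcal C$ and $\mathcal C_\times(X_1,\dots,X_n;X)=\mathcal C(X_1\times\cdots\times X_n,X)$, on which mappings act by precomposition with the corresponding arrows built from diagonals and projections. **Theorem.** The assignment $\mathcal C\mapsto\mathcal C_\times$ extends to a functor $\mathrm{Cat}^\times\to\mathrm{fpRep}$, sending $F$ to the fp-functor $f\mapsto F(f)$ (up to the canonical isomorphisms $FX_1\times\cdots\times FX_n\cong F(X_1\times\cdots\times X_n)$), and this functor is an equivalence of categories: $$\mathrm{fpRep}\simeq\mathrm{Cat}^\times .$$ More precisely, let $\mathbf M$ be a representable multicategory. Then $\mathbf M$ carries at most one fp-structure. If it carries one, then 1. for every representation $(\otimes,\eta)$ of $\mathbf M$ and every finite sequence $s=(X_1,\dots,X_n)$ of objects (including $n=0$), the object $\otimes s$ is a product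 of $X_1,\dots,X_n$ in the underlying category $\underline{\mathbf M}$ of unary arrows, with as projections the arrows $\pi_i:\otimes s\to X_i$ for which $\pi_i\,\eta_s\in\mathbf M(X_1,\dots,X_n;X_i)$ is the result of the action on $\mathrm{id}_{X_i}$ of the mapping $\{1\}\to\{1,\dots,n\}$, $1\mapsto i$; 2. $\underline{\mathbf M}$ has finite products, and $\mathbf M\cong\mathcal C_\times$ as cartesian multicategories, for $\mathcal C=\underline{\mathbf M}$. -/

import Mathlib

open CategoryTheory CategoryTheory.Limits

universe v u

noncomputable section

namespace CartMulti

/-! ### Finite sequences and the comma category `N / O` -/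

/-- A finite sequence of elements of `O`, that is, a mapping `{1, …, n} → O`. -/
@[ext] structure Ctx (O : Type u) where
  len : ℕ
  get : Fin len → O

namespace Ctx

variable {O : Type u}

/-- A map `s → t` in `N / O`: a mapping of the index sets over `O`. -/
@[ext] structure Map (s t : Ctx O) where
  fn : Fin s.len → Fin t.len
  get_fn : ∀ i, t.get (fn i) = s.get i

instance : Category (Ctx O) where
  Hom := Map
  id s := ⟨id, fun _ => rfl⟩
  comp p q := ⟨q.fn ∘ p.fn, fun i => (q.get_fn _).trans (p.get_fn i)⟩

/-- The one-term sequence `⟨X⟩`. -/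
abbrev single (X : O) : Ctx O := ⟨1, fun _ => X⟩

/-- Apply `F : O → O'` to each term. -/
abbrev mapObj {O' : Type*} (F : O → O') (s : Ctx O) : Ctx O' := ⟨s.len, fun i => F (s.get i)⟩

/-- Concatenation of a finite sequence of finite sequences.  `finSigmaFinEquiv` identifies the
pairs `(i, j)`, in lexicographic order, with the positions in the concatenation. -/
abbrev concat {n : ℕ} (t : Fin n → Ctx O) : Ctx O where
  len := ∑ i, (t i).len
  get k := (t (finSigmaFinEquiv.symm k).1).get (finSigmaFinEquiv.symm k).2

/-- The positions of a concatenation, as pairs (block, position in the block). -/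
abbrev pos {n : ℕ} (t : Fin n → Ctx O) : (Σ i, Fin (t i).len) ≃ Fin (concat t).len :=
  finSigmaFinEquiv

lemma get_pos {n : ℕ} (t : Fin n → Ctx O) (i : Fin n) (j : Fin (t i).len) :
    (concat t).get (pos t ⟨i, j⟩) = (t i).get j := by
  have h : finSigmaFinEquiv.symm (pos t ⟨i, j⟩) = ⟨i, j⟩ := Equiv.symm_apply_apply _ _
  change (t (finSigmaFinEquiv.symm (pos t ⟨i, j⟩)).1).get _ = _
  rw [h]

/-- The inclusion of the term `s i` in `s`. -/
def term (s : Ctx O) (i : Fin s.len) : single (s.get i) ⟶ s where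
  fn _ := i
  get_fn _ := rfl

/-- The inclusion of the `i`-th block in a concatenation. -/
def incl {n : ℕ} (t : Fin n → Ctx O) (i : Fin n) : t i ⟶ concat t where
  fn j := pos t ⟨i, j⟩
  get_fn j := get_pos t i j

/-- The sum `p₁ + ⋯ + pₙ` of maps over `O`. -/
def sumMap {n : ℕ} {t t' : Fin n → Ctx O} (p : ∀ i, t i ⟶ t' i) : concat t ⟶ concat t' where
  fn k := pos t' ⟨((pos t).symm k).1, (p _).fn ((pos t).symm k).2⟩
  get_fn k := (get_pos _ _ _).trans ((p _).get_fn _)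

/-- The source `r ∘ p` of the map `p` over `O` with target `r`. -/
abbrev pull (r : Ctx O) {n : ℕ} (p : Fin n → Fin r.len) : Ctx O := ⟨n, fun i => r.get (p i)⟩

/-- The mapping `p`, as a map over `O` from `r ∘ p` to `r`.  Every map over `O` is of this form. -/
def pullMap (r : Ctx O) {n : ℕ} (p : Fin n → Fin r.len) : r.pull p ⟶ r := ⟨p, fun _ => rfl⟩

/-- The map `p'` that sends the `i`-th block identically onto the `p i`-th block. -/
def blockMap {m n : ℕ} (t : Fin m → Ctx O) (p : Fin n → Fin m) :
    concat (fun i => t (p i)) ⟶ concat t where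
  fn k := pos t ⟨p ((pos fun i => t (p i)).symm k).1, ((pos fun i => t (p i)).symm k).2⟩
  get_fn _ := get_pos _ _ _

/-! #### Equalities of concatenations -/

lemma eq_of_mono {a b : Ctx O} (p : a ⟶ b) (hm : StrictMono p.fn)
    (hs : Function.Surjective p.fn) : ∃ h : a = b, p = eqToHom h := by
  have hl : a.len = b.len := by
    simpa using Fintype.card_congr (Equiv.ofBijective p.fn ⟨hm.injective, hs⟩)
  obtain ⟨n, f⟩ := a
  obtain ⟨m, g⟩ := b
  obtain rfl : n = m := hl
  have hp : p.fn = id := by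
    have := Subsingleton.elim (hm.orderIsoOfSurjective p.fn hs) (OrderIso.refl (Fin n))
    funext i
    exact congrArg (fun e : Fin n ≃o Fin n => e i) this
  obtain ⟨fn, hg⟩ := p
  change fn = id at hp
  subst hp
  obtain rfl : g = f := funext hg
  exact ⟨rfl, rfl⟩

lemma pos_val {n : ℕ} (t : Fin n → Ctx O) (i : Fin n) (j : Fin (t i).len) :
    (pos t ⟨i, j⟩ : ℕ) = ∑ l ∈ Finset.range i, (if h : l < n then (t ⟨l, h⟩).len else 0) + j := by
  have h := finSigmaFinEquiv_apply (n := fun i => (t i).len) ⟨i, j⟩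
  refine h.trans ?_
  congr 1
  rw [Finset.sum_range]
  refine Finset.sum_congr rfl fun l _ => ?_
  rw [dif_pos (l.2.trans i.2)]
  rfl

lemma pos_lt_of_fst {n : ℕ} (t : Fin n → Ctx O) {i i' : Fin n} (h : i < i')
    (j : Fin (t i).len) (j' : Fin (t i').len) : pos t ⟨i, j⟩ < pos t ⟨i', j'⟩ := by
  rw [Fin.lt_def, pos_val, pos_val]
  have h1 : ∑ l ∈ Finset.range (i + 1), (if h : l < n then (t ⟨l, h⟩).len else 0) ≤
      ∑ l ∈ Finset.range i', (if h : l < n then (t ⟨l, h⟩).len else 0) :=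
    Finset.sum_le_sum_of_subset (Finset.range_mono h)
  rw [Finset.sum_range_succ, dif_pos i.2] at h1
  have := j.2
  simp only [Fin.eta] at h1
  omega

lemma pos_lt_of_snd {n : ℕ} (t : Fin n → Ctx O) {i : Fin n}
    {j j' : Fin (t i).len} (h : j < j') : pos t ⟨i, j⟩ < pos t ⟨i, j'⟩ := by
  rw [Fin.lt_def, pos_val, pos_val]
  have : (j : ℕ) < j' := h
  omega

lemma pos_lt {n : ℕ} (t : Fin n → Ctx O) {i i' : Fin n}
    {j : Fin (t i).len} {j' : Fin (t i').len} (h : pos t ⟨i, j⟩ < pos t ⟨i', j'⟩) :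
    i < i' ∨ ∃ e : i = i', Fin.cast (by rw [e]) j < j' := by
  rcases lt_trichotomy i i' with h1 | h1 | h1
  · exact Or.inl h1
  · subst h1
    refine Or.inr ⟨rfl, ?_⟩
    by_contra h2
    rcases (not_lt.mp h2).lt_or_eq with h3 | h3
    · exact lt_asymm h (pos_lt_of_snd t h3)
    · subst h3
      exact lt_irrefl _ h
  · exact absurd h (lt_asymm (pos_lt_of_fst t h1 j' j))

/-- The identification of `t` with the concatenation of the one-term sequence `⟨t⟩`. -/
lemma incl_mono (t : Ctx O) : StrictMono (incl (fun _ : Fin 1 => t) 0).fn ∧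
    Function.Surjective (incl (fun _ : Fin 1 => t) 0).fn := by
  refine ⟨fun j j' h => pos_lt_of_snd (fun _ : Fin 1 => t) h, fun k => ?_⟩
  obtain ⟨⟨i, j⟩, rfl⟩ := (pos fun _ : Fin 1 => t).surjective k
  obtain rfl : i = 0 := Subsingleton.elim _ _
  exact ⟨j, rfl⟩

lemma concat_one (t : Ctx O) : concat (fun _ : Fin 1 => t) = t :=
  (eq_of_mono _ (incl_mono t).1 (incl_mono t).2).1.symm

/-- The identification of `s` with the concatenation of its terms. -/
def toSingles (s : Ctx O) : s ⟶ concat (fun i => single (s.get i)) where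
  fn i := pos (fun i => single (s.get i)) ⟨i, (0 : Fin 1)⟩
  get_fn _ := get_pos _ _ _

lemma toSingles_mono (s : Ctx O) :
    StrictMono s.toSingles.fn ∧ Function.Surjective s.toSingles.fn := by
  refine ⟨fun i i' h => pos_lt_of_fst (fun i => single (s.get i)) h _ _, fun k => ?_⟩
  obtain ⟨⟨i, j⟩, rfl⟩ := (pos fun i => single (s.get i)).surjective k
  change Fin 1 at j
  obtain rfl : j = 0 := Subsingleton.elim _ _
  exact ⟨i, rfl⟩

/-- The identification of the two ways to concatenate a doubly indexed sequence of sequences. -/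
def concatAssoc {n : ℕ} (t : Fin n → Ctx O) (r : ∀ i, Fin (t i).len → Ctx O) :
    concat (fun k : Fin (concat t).len => r ((pos t).symm k).1 ((pos t).symm k).2) ⟶
      concat (fun i => concat (r i)) where
  fn l :=
    let k := ((pos fun k : Fin (concat t).len =>
      r ((pos t).symm k).1 ((pos t).symm k).2).symm l)
    pos (fun i => concat (r i))
      ⟨((pos t).symm k.1).1, pos (r ((pos t).symm k.1).1) ⟨((pos t).symm k.1).2, k.2⟩⟩
  get_fn l := by
    rw [get_pos, get_pos]

lemma concatAssoc_fn {n : ℕ} (t : Fin n → Ctx O) (r : ∀ i, Fin (t i).len → Ctx O)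
    (k : Fin (concat t).len) (x : Fin (r ((pos t).symm k).1 ((pos t).symm k).2).len) :
    (concatAssoc t r).fn (pos (fun k : Fin (concat t).len =>
      r ((pos t).symm k).1 ((pos t).symm k).2) ⟨k, x⟩) =
    pos (fun i => concat (r i)) ⟨((pos t).symm k).1,
      pos (r ((pos t).symm k).1) ⟨((pos t).symm k).2, x⟩⟩ := by
  simp only [concatAssoc]
  rw [Equiv.symm_apply_apply]

lemma concatAssoc_mono {n : ℕ} (t : Fin n → Ctx O) (r : ∀ i, Fin (t i).len → Ctx O) :
    StrictMono (concatAssoc t r).fn ∧ Function.Surjective (concatAssoc t r).fn := by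
  constructor
  · intro l l' h
    obtain ⟨⟨k, x⟩, rfl⟩ := (pos fun k : Fin (concat t).len =>
      r ((pos t).symm k).1 ((pos t).symm k).2).surjective l
    obtain ⟨⟨k', x'⟩, rfl⟩ := (pos fun k : Fin (concat t).len =>
      r ((pos t).symm k).1 ((pos t).symm k).2).surjective l'
    rw [concatAssoc_fn, concatAssoc_fn]
    rcases pos_lt _ h with h1 | ⟨rfl, h1⟩
    · have h2 : pos t ((pos t).symm k) < pos t ((pos t).symm k') := by simpa using h1
      clear h h1
      revert x x' h2
      generalize (pos t).symm k = y
      generalize (pos t).symm k' = y'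
      obtain ⟨i, j⟩ := y
      obtain ⟨i', j'⟩ := y'
      intro x x' h2
      rcases pos_lt t h2 with h3 | ⟨rfl, h3⟩
      · exact pos_lt_of_fst (fun i => concat (r i)) h3 _ _
      · exact pos_lt_of_snd (fun i => concat (r i)) (pos_lt_of_fst (r i) h3 _ _)
    · exact pos_lt_of_snd (fun i => concat (r i)) (pos_lt_of_snd (r _) h1)
  · intro l
    obtain ⟨⟨i, y⟩, rfl⟩ := (pos fun i => concat (r i)).surjective l
    obtain ⟨⟨j, x⟩, rfl⟩ := (pos (r i)).surjective y
    have key : ∀ (z : Σ i, Fin (t i).len) (x : Fin (r z.1 z.2).len),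
        ∃ a, (concatAssoc t r).fn a =
          pos (fun i => concat (r i)) ⟨z.1, pos (r z.1) ⟨z.2, x⟩⟩ := by
      intro z
      obtain ⟨k, rfl⟩ := (pos t).symm.surjective z
      exact fun x => ⟨_, concatAssoc_fn t r k x⟩
    exact key ⟨i, j⟩ x

lemma incl_sumMap {n : ℕ} {t t' : Fin n → Ctx O} (p : ∀ i, t i ⟶ t' i) (i : Fin n) :
    incl t i ≫ sumMap p = p i ≫ incl t' i := by
  refine Map.ext (funext fun j => ?_)
  change pos t' ⟨((pos t).symm (pos t ⟨i, j⟩)).1, _⟩ = pos t' ⟨i, (p i).fn j⟩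
  have key : ∀ z : Σ i, Fin (t i).len, z = ⟨i, j⟩ →
      pos t' ⟨z.1, (p z.1).fn z.2⟩ = pos t' ⟨i, (p i).fn j⟩ := by
    rintro _ rfl
    rfl
  exact key _ (Equiv.symm_apply_apply _ _)

lemma incl_blockMap {m n : ℕ} (t : Fin m → Ctx O) (p : Fin n → Fin m) (i : Fin n) :
    incl (fun i => t (p i)) i ≫ blockMap t p = incl t (p i) := by
  refine Map.ext (funext fun j => ?_)
  change pos t ⟨p ((pos fun i => t (p i)).symm (pos (fun i => t (p i)) ⟨i, j⟩)).1, _⟩ =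
    pos t ⟨p i, j⟩
  have key : ∀ z : Σ i, Fin (t (p i)).len, z = ⟨i, j⟩ →
      pos t ⟨p z.1, z.2⟩ = pos t ⟨p i, j⟩ := by
    rintro _ rfl
    rfl
  exact key _ (Equiv.symm_apply_apply _ _)

lemma incl_concatAssoc {n : ℕ} (t : Fin n → Ctx O) (r : ∀ i, Fin (t i).len → Ctx O)
    (k : Fin (concat t).len) :
    incl (fun k : Fin (concat t).len =>
        r ((pos t).symm k).1 ((pos t).symm k).2) k ≫ concatAssoc t r =
      incl (r ((pos t).symm k).1) ((pos t).symm k).2 ≫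
        incl (fun i => concat (r i)) ((pos t).symm k).1 :=
  Map.ext (funext fun x => concatAssoc_fn t r k x)

end Ctx

/-! ### Multicategories -/

/-- A (plain) multicategory.  In each of the three axioms the domains of the two sides are equal
sequences, but not by definition, whence the use of `≍`. -/
structure Multicategory where
  Obj : Type u
  Hom : Ctx Obj → Obj → Type v
  id (X : Obj) : Hom (Ctx.single X) X
  comp {s : Ctx Obj} {X : Obj} (f : Hom s X) {t : Fin s.len → Ctx Obj}
    (g : ∀ i, Hom (t i) (s.get i)) : Hom (Ctx.concat t) X
  id_comp {s : Ctx Obj} {X : Obj} (f : Hom s X) :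
    comp (id X) (t := fun _ => s) (fun _ => f) ≍ f
  comp_id {s : Ctx Obj} {X : Obj} (f : Hom s X) :
    comp f (fun i => id (s.get i)) ≍ f
  assoc {s : Ctx Obj} {X : Obj} (f : Hom s X) {t : Fin s.len → Ctx Obj}
    (g : ∀ i, Hom (t i) (s.get i)) {r : ∀ i, Fin (t i).len → Ctx Obj}
    (h : ∀ i j, Hom (r i j) ((t i).get j)) :
    comp (comp f g) (t := fun k => r ((Ctx.pos t).symm k).1 ((Ctx.pos t).symm k).2)
        (fun k => h ((Ctx.pos t).symm k).1 ((Ctx.pos t).symm k).2) ≍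
      comp f (fun i => comp (g i) (h i))

namespace Multicategory

/-- Composition `g(f) : s → Y` of an arrow `f : s → X` with a unary arrow `g : X → Y`. -/
def post (M : Multicategory.{v, u}) {s : Ctx M.Obj} {X Y : M.Obj}
    (g : M.Hom (Ctx.single X) Y) (f : M.Hom s X) : M.Hom s Y :=
  cast (congrArg (fun r => M.Hom r Y) (Ctx.concat_one s))
    (M.comp (s := Ctx.single X) g (t := fun _ => s) (fun _ => f))

lemma post_heq (M : Multicategory.{v, u}) {s : Ctx M.Obj} {X Y : M.Obj}
    (g : M.Hom (Ctx.single X) Y) (f : M.Hom s X) :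
    M.post g f ≍ M.comp (s := Ctx.single X) g (t := fun _ => s) (fun _ => f) :=
  cast_heq _ _

lemma comp_congr (M : Multicategory.{v, u}) {s s' : Ctx M.Obj} {X : M.Obj} (hs : s = s')
    {f : M.Hom s X} {f' : M.Hom s' X} (hf : f ≍ f') {t : Fin s.len → Ctx M.Obj}
    {t' : Fin s'.len → Ctx M.Obj} {g : ∀ i, M.Hom (t i) (s.get i)}
    {g' : ∀ i, M.Hom (t' i) (s'.get i)}
    (ht : ∀ (i : Fin s.len) (i' : Fin s'.len), (i : ℕ) = i' → t i = t' i')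
    (hg : ∀ (i : Fin s.len) (i' : Fin s'.len), (i : ℕ) = i' → g i ≍ g' i') :
    M.comp f g ≍ M.comp f' g' := by
  subst hs
  obtain rfl := eq_of_heq hf
  obtain rfl : t = t' := funext fun i => ht i i rfl
  obtain rfl : g = g' := funext fun i => eq_of_heq (hg i i rfl)
  rfl

lemma post_post (M : Multicategory.{v, u}) {s : Ctx M.Obj} {X Y Z : M.Obj}
    (h : M.Hom (Ctx.single Y) Z) (g : M.Hom (Ctx.single X) Y) (f : M.Hom s X) :
    M.post h (M.post g f) = M.post (M.post h g) f := by
  apply eq_of_heq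
  refine (M.post_heq _ _).trans (HEq.trans ?_ (M.post_heq _ _).symm)
  refine HEq.trans ?_ (HEq.trans (M.assoc (s := Ctx.single Y) h
    (t := fun _ => Ctx.single X) (fun _ => g) (r := fun _ _ => s) (fun _ _ => f)).symm ?_)
  · exact M.comp_congr rfl HEq.rfl (fun _ _ _ => (Ctx.concat_one s).symm)
      (fun _ _ _ => M.post_heq _ _)
  · exact M.comp_congr (Ctx.concat_one _) (M.post_heq _ _).symm (fun _ _ _ => rfl)
      (fun _ _ _ => HEq.rfl)

/-- The underlying category of a multicategory: same objects, unary arrows. -/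
def Underlying (M : Multicategory.{v, u}) : Type u := M.Obj

instance (M : Multicategory.{v, u}) : Category.{v} M.Underlying where
  Hom X Y := M.Hom (Ctx.single X) Y
  id X := M.id X
  comp f g := M.post g f
  id_comp f := eq_of_heq ((M.post_heq _ _).trans (M.comp_id f))
  comp_id f := eq_of_heq ((M.post_heq _ _).trans (M.id_comp f))
  assoc f g h := M.post_post h g f

/-- The objects `T s` and the arrows `u s : s → T s` represent the multicategory: every arrow
`t₁, …, tₙ → Z` (where each `tᵢ` is a finite sequence) factors uniquely through
`(u t₁, …, u tₙ)`. -/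
def IsRepresentation (M : Multicategory.{v, u}) (T : Ctx M.Obj → M.Obj)
    (u : ∀ s, M.Hom s (T s)) : Prop :=
  ∀ (n : ℕ) (t : Fin n → Ctx M.Obj) (Z : M.Obj),
    Function.Bijective fun f : M.Hom ⟨n, fun i => T (t i)⟩ Z => M.comp f (fun i => u (t i))

/-- Representable multicategories. -/
def IsRepresentable (M : Multicategory.{v, u}) : Prop :=
  ∃ (T : Ctx M.Obj → M.Obj) (u : ∀ s, M.Hom s (T s)), M.IsRepresentation T u

end Multicategory

/-- Functors of multicategories. -/
@[ext] structure Multifunctor (M N : Multicategory.{v, u}) where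
  obj : M.Obj → N.Obj
  map {s : Ctx M.Obj} {X : M.Obj} (f : M.Hom s X) : N.Hom (s.mapObj obj) (obj X)
  map_id (X : M.Obj) : map (M.id X) = N.id (obj X)
  map_comp {s : Ctx M.Obj} {X : M.Obj} (f : M.Hom s X) {t : Fin s.len → Ctx M.Obj}
    (g : ∀ i, M.Hom (t i) (s.get i)) :
    map (M.comp f g) = N.comp (s := s.mapObj obj) (map f) (fun i => map (g i))

/-! ### Cartesian multicategories -/

/-- An fp-structure on a multicategory: a functorial action of `N / obj M` on the hom-sets which
is compatible with composition. -/
@[ext] structure FpStructure (M : Multicategory.{v, u}) where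
  act {s t : Ctx M.Obj} (p : s ⟶ t) {X : M.Obj} (f : M.Hom s X) : M.Hom t X
  act_id {s : Ctx M.Obj} {X : M.Obj} (f : M.Hom s X) : act (𝟙 s) f = f
  act_comp {s t r : Ctx M.Obj} (p : s ⟶ t) (q : t ⟶ r) {X : M.Obj} (f : M.Hom s X) :
    act (p ≫ q) f = act q (act p f)
  /-- `f(p₁f₁, …, pₙfₙ) = (p₁ + ⋯ + pₙ) f(f₁, …, fₙ)` -/
  comp_act {s : Ctx M.Obj} {X : M.Obj} (f : M.Hom s X) {t t' : Fin s.len → Ctx M.Obj}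
    (p : ∀ i, t i ⟶ t' i) (g : ∀ i, M.Hom (t i) (s.get i)) :
    M.comp f (fun i => act (p i) (g i)) = act (Ctx.sumMap p) (M.comp f g)
  /-- `(pf)(f₁, …, fₘ) = p' f(f_{p1}, …, f_{pn})` -/
  act_comp' {r : Ctx M.Obj} {n : ℕ} (p : Fin n → Fin r.len) {X : M.Obj}
    (f : M.Hom (r.pull p) X) {t : Fin r.len → Ctx M.Obj} (g : ∀ j, M.Hom (t j) (r.get j)) :
    M.comp (act (r.pullMap p) f) g =
      act (Ctx.blockMap t p) (M.comp (s := r.pull p) f (fun i => g (p i)))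

/-- A map over `O`, transported along `F : O → O'`. -/
def Ctx.Map.mapObj {O : Type*} {O' : Type*} (F : O → O') {s t : Ctx O} (p : s ⟶ t) :
    s.mapObj F ⟶ t.mapObj F where
  fn := p.fn
  get_fn i := congrArg F (p.get_fn i)

/-- Cartesian multicategories. -/
structure FpMlt where
  M : Multicategory.{v, u}
  fp : FpStructure M

namespace FpMlt

/-- fp-functors: functors of multicategories that commute with the actions. -/
@[ext] structure Hom (A B : FpMlt.{v, u}) extends Multifunctor A.M B.M where
  map_act {s t : Ctx A.M.Obj} (p : s ⟶ t) {X : A.M.Obj} (f : A.M.Hom s X) :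
    map (A.fp.act p f) = B.fp.act (Ctx.Map.mapObj obj p) (map f)

instance : Category FpMlt.{v, u} where
  Hom := Hom
  id A :=
    { obj := fun X => X
      map := fun f => f
      map_id := fun _ => rfl
      map_comp := fun _ _ _ => rfl
      map_act := fun _ _ _ => rfl }
  comp F G :=
    { obj := fun X => G.obj (F.obj X)
      map := fun f => G.map (F.map f)
      map_id := fun X => (congrArg G.map (F.map_id X)).trans (G.map_id _)
      map_comp := fun f _ g => (congrArg G.map (F.map_comp f g)).trans (G.map_comp _ _)
      map_act := fun p _ f => (congrArg G.map (F.map_act p f)).trans (G.map_act _ _) }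

end FpMlt

/-- The full subcategory of `FpMlt` on the representable cartesian multicategories. -/
abbrev FpRep : Type (max (u + 1) (v + 1)) :=
  ObjectProperty.FullSubcategory (C := FpMlt.{v, u}) fun A => A.M.IsRepresentable

/-! ### Finite product categories -/

/-- Finite product categories. -/
structure FPCat where
  carrier : Type u
  [cat : Category.{v} carrier]
  [hasFiniteProducts : HasFiniteProducts carrier]

attribute [instance] FPCat.cat FPCat.hasFiniteProducts

/-- Morphisms of finite product categories: finite product preserving functors. -/
@[ext] structure FPCat.Hom (C D : FPCat.{v, u}) where
  functor : C.carrier ⥤ D.carrier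
  preserves : PreservesFiniteProducts functor

instance : Category FPCat.{v, u} where
  Hom := FPCat.Hom
  id C := ⟨𝟭 C.carrier, inferInstance⟩
  comp F G := ⟨F.functor ⋙ G.functor,
    haveI := F.preserves
    haveI := G.preserves
    inferInstance⟩

/-! ### The cartesian multicategory of a finite product category -/

section Times

variable {C : Type u} [Category.{v} C] [HasFiniteProducts C]

/-- The arrow `∏ t ⟶ ∏ s` (built from diagonals and projections) given by `p : s ⟶ t`. -/
def reindex {s t : Ctx C} (p : s ⟶ t) : ∏ᶜ t.get ⟶ ∏ᶜ s.get :=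
  Pi.lift fun i => Pi.π t.get (p.fn i) ≫ eqToHom (p.get_fn i)

@[simp]
lemma reindex_π {s t : Ctx C} (p : s ⟶ t) (i : Fin s.len) :
    reindex p ≫ Pi.π s.get i = Pi.π t.get (p.fn i) ≫ eqToHom (p.get_fn i) := by
  simp [reindex]

@[simp]
lemma reindex_π_assoc {s t : Ctx C} (p : s ⟶ t) (i : Fin s.len) {Z : C} (h : s.get i ⟶ Z) :
    reindex p ≫ Pi.π s.get i ≫ h = Pi.π t.get (p.fn i) ≫ eqToHom (p.get_fn i) ≫ h := by
  rw [← Category.assoc, reindex_π, Category.assoc]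

lemma π_congr {s : Ctx C} {i i' : Fin s.len} (h : i = i') {Z : C} (e : s.get i = Z) :
    Pi.π s.get i ≫ eqToHom e = Pi.π s.get i' ≫ eqToHom (h ▸ e) := by
  subst h
  rfl

lemma reindex_id (s : Ctx C) : reindex (𝟙 s) = 𝟙 _ := by
  refine Pi.hom_ext _ _ fun i => ?_
  rw [reindex_π]
  exact (Category.comp_id _).trans (Category.id_comp _).symm

lemma reindex_comp {s t r : Ctx C} (p : s ⟶ t) (q : t ⟶ r) :
    reindex (p ≫ q) = reindex q ≫ reindex p := by
  refine Pi.hom_ext _ _ fun i => ?_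
  simp only [reindex_π, Category.assoc, reindex_π_assoc, eqToHom_trans]
  rfl

lemma heq_of_mono {s t : Ctx C} {X : C} (p : s ⟶ t)
    (hp : StrictMono p.fn ∧ Function.Surjective p.fn) {f : ∏ᶜ s.get ⟶ X} {g : ∏ᶜ t.get ⟶ X}
    (h : g = reindex p ≫ f) : g ≍ f := by
  obtain ⟨rfl, rfl⟩ := Ctx.eq_of_mono p hp.1 hp.2
  rw [h]
  change reindex (𝟙 s) ≫ f ≍ f
  rw [reindex_id, Category.id_comp]

/-- The arrow `∏ (concat t) ⟶ ∏ s` whose components are given by the arrows `g i : ∏ (t i) ⟶ s i`: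
the product of the arrows `g i`, up to the canonical isomorphism. -/
def prodArrow {s : Ctx C} {t : Fin s.len → Ctx C} (g : ∀ i, ∏ᶜ (t i).get ⟶ s.get i) :
    ∏ᶜ (Ctx.concat t).get ⟶ ∏ᶜ s.get :=
  Pi.lift fun i => reindex (Ctx.incl t i) ≫ g i

@[simp]
lemma prodArrow_π {s : Ctx C} {t : Fin s.len → Ctx C} (g : ∀ i, ∏ᶜ (t i).get ⟶ s.get i)
    (i : Fin s.len) : prodArrow g ≫ Pi.π s.get i = reindex (Ctx.incl t i) ≫ g i := by
  simp [prodArrow]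

@[simp]
lemma prodArrow_π_assoc {s : Ctx C} {t : Fin s.len → Ctx C} (g : ∀ i, ∏ᶜ (t i).get ⟶ s.get i)
    (i : Fin s.len) {Z : C} (h : s.get i ⟶ Z) :
    prodArrow g ≫ Pi.π s.get i ≫ h = reindex (Ctx.incl t i) ≫ g i ≫ h := by
  rw [← Category.assoc, prodArrow_π, Category.assoc]

lemma prodArrow_id {X : C} {t : Ctx C} (g : ∏ᶜ t.get ⟶ X) :
    prodArrow (s := Ctx.single X) (t := fun _ => t) (fun _ => g) ≫
        Pi.π (fun _ : Fin 1 => X) 0 =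
      reindex (Ctx.incl (fun _ : Fin 1 => t) 0) ≫ g :=
  prodArrow_π (s := Ctx.single X) (t := fun _ => t) (fun _ => g) (0 : Fin 1)

lemma prodArrow_singles (s : Ctx C) :
    prodArrow (s := s) (t := fun i => Ctx.single (s.get i))
      (fun i => Pi.π (fun _ : Fin 1 => s.get i) 0) = reindex s.toSingles := by
  refine Pi.hom_ext _ _ fun i => ?_
  refine (prodArrow_π (t := fun i => Ctx.single (s.get i))
      (fun i => Pi.π (fun _ : Fin 1 => s.get i) 0) i).trans ?_
  refine Eq.trans ?_ (reindex_π s.toSingles i).symm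
  exact reindex_π (Ctx.incl (fun i => Ctx.single (s.get i)) i) (0 : Fin 1)

lemma prodArrow_assoc {s : Ctx C} {t : Fin s.len → Ctx C} (g : ∀ i, ∏ᶜ (t i).get ⟶ s.get i)
    {r : ∀ i, Fin (t i).len → Ctx C} (h : ∀ i j, ∏ᶜ (r i j).get ⟶ (t i).get j) :
    prodArrow (s := s) (t := fun i => Ctx.concat (r i)) (fun i => prodArrow (h i) ≫ g i) =
      reindex (Ctx.concatAssoc t r) ≫
        prodArrow (s := Ctx.concat t) (fun k => h ((Ctx.pos t).symm k).1 ((Ctx.pos t).symm k).2) ≫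
          prodArrow g := by
  refine Pi.hom_ext _ _ fun i => ?_
  rw [prodArrow_π, Category.assoc, Category.assoc, prodArrow_π]
  rw [← Category.assoc, ← Category.assoc, ← Category.assoc]
  congr 1
  refine Pi.hom_ext _ _ fun j => ?_
  rw [Category.assoc, prodArrow_π, Category.assoc, reindex_π, Category.assoc]
  have h1 := prodArrow_π_assoc (s := Ctx.concat t)
    (fun k => h ((Ctx.pos t).symm k).1 ((Ctx.pos t).symm k).2) ((Ctx.incl t i).fn j)
    (eqToHom ((Ctx.incl t i).get_fn j))
  refine Eq.trans ?_ (congrArg (reindex (Ctx.concatAssoc t r) ≫ ·) h1.symm)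
  rw [← Category.assoc, ← Category.assoc, ← reindex_comp, ← reindex_comp, Ctx.incl_concatAssoc]
  have key : ∀ (z : Σ i, Fin (t i).len) (e : (t z.1).get z.2 = (t i).get j), z = ⟨i, j⟩ →
      reindex (Ctx.incl (r i) j ≫ Ctx.incl (fun i => Ctx.concat (r i)) i) ≫ h i j =
      reindex (Ctx.incl (r z.1) z.2 ≫ Ctx.incl (fun i => Ctx.concat (r i)) z.1) ≫
        h z.1 z.2 ≫ eqToHom e := by
    rintro _ e rfl
    exact congrArg _ (Category.comp_id _).symm
  exact key ((Ctx.pos t).symm (Ctx.pos t ⟨i, j⟩)) _ (Equiv.symm_apply_apply _ _)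

lemma prodArrow_reindex {s : Ctx C} {t t' : Fin s.len → Ctx C} (p : ∀ i, t i ⟶ t' i)
    (g : ∀ i, ∏ᶜ (t i).get ⟶ s.get i) :
    prodArrow (fun i => reindex (p i) ≫ g i) = reindex (Ctx.sumMap p) ≫ prodArrow g := by
  refine Pi.hom_ext _ _ fun i => ?_
  rw [prodArrow_π, Category.assoc, prodArrow_π, ← Category.assoc, ← Category.assoc,
    ← reindex_comp, ← reindex_comp, Ctx.incl_sumMap]

lemma reindex_pullMap_π {r : Ctx C} {n : ℕ} (p : Fin n → Fin r.len) (i : Fin n) :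
    reindex (r.pullMap p) ≫ Pi.π (r.pull p).get i = Pi.π r.get (p i) :=
  (reindex_π _ _).trans (Category.comp_id _)

lemma prodArrow_pullMap {r : Ctx C} {n : ℕ} (p : Fin n → Fin r.len) {t : Fin r.len → Ctx C}
    (g : ∀ j, ∏ᶜ (t j).get ⟶ r.get j) :
    prodArrow g ≫ reindex (r.pullMap p) =
      reindex (Ctx.blockMap t p) ≫
        prodArrow (s := r.pull p) (t := fun i => t (p i)) (fun i => g (p i)) := by
  refine Pi.hom_ext _ _ fun i => ?_
  rw [Category.assoc, Category.assoc, reindex_pullMap_π, prodArrow_π]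
  refine Eq.trans ?_ (congrArg (reindex (Ctx.blockMap t p) ≫ ·)
    (prodArrow_π (s := r.pull p) (t := fun i => t (p i)) (fun i => g (p i)) i).symm)
  change _ = reindex (Ctx.blockMap t p) ≫ reindex (Ctx.incl (fun i => t (p i)) i) ≫ g (p i)
  rw [← Category.assoc, ← reindex_comp, Ctx.incl_blockMap]

/-- The inverse of the canonical isomorphism `∏ (concat t) ⟶ ∏ᵢ ∏ (t i)`. -/
def unpack {n : ℕ} (t : Fin n → Ctx C) :
    ∏ᶜ (fun i => ∏ᶜ (t i).get) ⟶ ∏ᶜ (Ctx.concat t).get :=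
  Pi.lift fun k => Pi.π (fun i => ∏ᶜ (t i).get) ((Ctx.pos t).symm k).1 ≫
    Pi.π (t ((Ctx.pos t).symm k).1).get ((Ctx.pos t).symm k).2

lemma unpack_incl {n : ℕ} (t : Fin n → Ctx C) (i : Fin n) :
    unpack t ≫ reindex (Ctx.incl t i) = Pi.π (fun i => ∏ᶜ (t i).get) i := by
  refine Pi.hom_ext _ _ fun j => ?_
  rw [Category.assoc, reindex_π, ← Category.assoc]
  have key : ∀ (z : Σ i, Fin (t i).len) (e : (t z.1).get z.2 = (t i).get j), z = ⟨i, j⟩ →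
      (Pi.π (fun i => ∏ᶜ (t i).get) z.1 ≫ Pi.π (t z.1).get z.2) ≫ eqToHom e =
        Pi.π (fun i => ∏ᶜ (t i).get) i ≫ Pi.π (t i).get j := by
    rintro _ e rfl
    exact Category.comp_id _
  refine Eq.trans ?_ (key _ ((Ctx.incl t i).get_fn j) (Equiv.symm_apply_apply (Ctx.pos t) ⟨i, j⟩))
  exact congrArg (· ≫ eqToHom ((Ctx.incl t i).get_fn j))
    (Limits.Pi.lift_π _ ((Ctx.incl t i).fn j))

lemma pack_unpack {n : ℕ} (t : Fin n → Ctx C) {a : ∏ᶜ (Ctx.concat t).get ⟶ ∏ᶜ _}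
    (ha : ∀ i, a ≫ Pi.π (fun i => ∏ᶜ (t i).get) i = reindex (Ctx.incl t i)) :
    a ≫ unpack t = 𝟙 _ := by
  refine Pi.hom_ext _ _ fun k => ?_
  have h1 : unpack t ≫ Pi.π (Ctx.concat t).get k =
      Pi.π (fun i => ∏ᶜ (t i).get) ((Ctx.pos t).symm k).1 ≫
        Pi.π (t ((Ctx.pos t).symm k).1).get ((Ctx.pos t).symm k).2 :=
    Limits.Pi.lift_π _ _
  rw [Category.assoc, h1, ← Category.assoc, ha, reindex_π, Category.id_comp]
  have h2 : (Ctx.incl t ((Ctx.pos t).symm k).1).fn ((Ctx.pos t).symm k).2 = k :=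
    Equiv.apply_symm_apply (Ctx.pos t) k
  exact (π_congr h2 _).trans (Category.comp_id _)

variable (C)

/-- The multicategory `C_×`, with `C_×(X₁, …, Xₙ; X) = C(X₁ × ⋯ × Xₙ, X)`. -/
def timesMulticategory : Multicategory.{v, u} where
  Obj := C
  Hom s X := ∏ᶜ s.get ⟶ X
  id X := Pi.π (fun _ : Fin 1 => X) (0 : Fin 1)
  comp f _ g := prodArrow g ≫ f
  id_comp {s _} f := heq_of_mono _ (Ctx.incl_mono s) (prodArrow_id f)
  comp_id {s _} f :=
    heq_of_mono _ (Ctx.toSingles_mono s) (congrArg (· ≫ f) (prodArrow_singles s))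
  assoc {_ _} f t g r h :=
    (heq_of_mono _ (Ctx.concatAssoc_mono t r)
      ((congrArg (· ≫ f) (prodArrow_assoc g h)).trans (by simp only [Category.assoc]))).symm

/-- The fp-structure of `C_×`, given by composition with diagonals and projections. -/
def timesFp : FpStructure (timesMulticategory C) where
  act p _ f := reindex (C := C) p ≫ f
  act_id {s _} f :=
    (congrArg (· ≫ f) (reindex_id (C := C) s)).trans (Category.id_comp (X := ∏ᶜ _) f)
  act_comp p q _ f := (congrArg (· ≫ f) (reindex_comp (C := C) p q)).trans (Category.assoc _ _ _)
  comp_act f _ _ p g :=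
    (congrArg (· ≫ f) (prodArrow_reindex (C := C) p g)).trans (Category.assoc _ _ _)
  act_comp' p _ f _ g := (Category.assoc _ _ _).symm.trans
    ((congrArg (· ≫ f) (prodArrow_pullMap (C := C) p g)).trans (Category.assoc _ _ _))

lemma timesMulticategory_isRepresentable : (timesMulticategory C).IsRepresentable := by
  refine ⟨fun s : Ctx C => (∏ᶜ s.get : C), fun s : Ctx C => 𝟙 (∏ᶜ s.get : C), fun n t Z => ?_⟩
  have key : ∀ (t : Fin n → Ctx C) (Z : C), Function.Bijective
      fun f : ∏ᶜ (fun i => ∏ᶜ (t i).get) ⟶ Z =>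
        prodArrow (s := ⟨n, fun i => ∏ᶜ (t i).get⟩) (t := t) (fun i => 𝟙 (∏ᶜ (t i).get)) ≫ f := by
    intro t Z
    have ha : ∀ i, prodArrow (s := ⟨n, fun i => ∏ᶜ (t i).get⟩) (t := t)
        (fun i => 𝟙 (∏ᶜ (t i).get)) ≫ Pi.π (fun i => ∏ᶜ (t i).get) i =
        reindex (Ctx.incl t i) := fun i =>
      (prodArrow_π (s := ⟨n, fun i => ∏ᶜ (t i).get⟩) (t := t)
        (fun i => 𝟙 (∏ᶜ (t i).get)) i).trans (Category.comp_id _)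
    have hab := pack_unpack t ha
    have hba : unpack t ≫ prodArrow (s := ⟨n, fun i => ∏ᶜ (t i).get⟩) (t := t)
        (fun i => 𝟙 (∏ᶜ (t i).get)) = 𝟙 _ := by
      refine Pi.hom_ext _ _ fun i => ?_
      refine (Category.assoc _ _ _).trans ?_
      refine (congrArg (unpack t ≫ ·) (ha i)).trans ?_
      exact (unpack_incl t i).trans (Category.id_comp _).symm
    constructor
    · intro f f' h
      have h2 := congrArg (unpack t ≫ ·) h
      simp only [← Category.assoc] at h2
      rw [hba] at h2
      simpa using h2
    · intro f
      refine ⟨unpack t ≫ f, ?_⟩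
      exact (Category.assoc _ _ _).symm.trans
        ((congrArg (· ≫ f) hab).trans (Category.id_comp _))
  exact key t Z

end Times

/-! ### The functor `(-)_×` -/

section TimesMap

variable {C : Type u} [Category.{v} C] [HasFiniteProducts C]
  {D : Type u} [Category.{v} D] [HasFiniteProducts D]
  {E : Type u} [Category.{v} E] [HasFiniteProducts E]
  (F : C ⥤ D) [PreservesFiniteProducts F] (G : D ⥤ E) [PreservesFiniteProducts G]

/-- The action of a finite product preserving functor `F` on the arrows of `C_×`: it sends
`f : X₁ × ⋯ × Xₙ ⟶ X` to `F f`, precomposed with `F X₁ × ⋯ × F Xₙ ≅ F (X₁ × ⋯ × Xₙ)`. -/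
def mapArrow {s : Ctx C} {X : C} (f : ∏ᶜ s.get ⟶ X) :
    ∏ᶜ (s.mapObj F.obj).get ⟶ F.obj X :=
  inv (piComparison F s.get) ≫ F.map f

lemma mapArrow_eq {s : Ctx C} {X : C} (f : ∏ᶜ s.get ⟶ X)
    {g : ∏ᶜ (s.mapObj F.obj).get ⟶ F.obj X} (h : F.map f = piComparison F s.get ≫ g) :
    mapArrow F f = g :=
  (IsIso.inv_comp_eq _).2 h

lemma piComparison_mapArrow {s : Ctx C} {X : C} (f : ∏ᶜ s.get ⟶ X) :
    piComparison F s.get ≫ mapArrow F f = F.map f :=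
  IsIso.hom_inv_id_assoc _ _

lemma piComparison_reindex {s t : Ctx C} (p : s ⟶ t) :
    piComparison F t.get ≫ reindex (Ctx.Map.mapObj F.obj p) =
      F.map (reindex p) ≫ piComparison F s.get := by
  refine Pi.hom_ext _ _ fun i => ?_
  have h1 : reindex (Ctx.Map.mapObj F.obj p) ≫ Pi.π (fun i => F.obj (s.get i)) i =
      Pi.π (fun i => F.obj (t.get i)) (p.fn i) ≫ eqToHom (congrArg F.obj (p.get_fn i)) :=
    reindex_π (Ctx.Map.mapObj F.obj p) i
  have h2 := piComparison_comp_π F t.get (p.fn i)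
  refine (Category.assoc _ _ _).trans ?_
  refine (congrArg (piComparison F t.get ≫ ·) h1).trans ?_
  rw [Category.assoc, piComparison_comp_π, ← F.map_comp, reindex_π, F.map_comp, eqToHom_map]
  exact (Category.assoc _ _ _).symm.trans (congrArg (· ≫ _) h2)

lemma mapArrow_id (X : C) : mapArrow F (s := Ctx.single X) (Pi.π (fun _ : Fin 1 => X) 0) =
    Pi.π (fun _ : Fin 1 => F.obj X) 0 :=
  mapArrow_eq F _ (piComparison_comp_π F (fun _ : Fin 1 => X) 0).symm

lemma mapArrow_reindex {s t : Ctx C} (p : s ⟶ t) {X : C} (f : ∏ᶜ s.get ⟶ X) :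
    mapArrow F (reindex p ≫ f) = reindex (Ctx.Map.mapObj F.obj p) ≫ mapArrow F f := by
  refine mapArrow_eq F _ ?_
  refine Eq.trans ?_ (Category.assoc _ _ _)
  refine Eq.trans ?_ (congrArg (· ≫ mapArrow F f) (piComparison_reindex F p).symm)
  rw [Category.assoc, piComparison_mapArrow, F.map_comp]

lemma mapArrow_comp {s : Ctx C} {X : C} (f : ∏ᶜ s.get ⟶ X) {t : Fin s.len → Ctx C}
    (g : ∀ i, ∏ᶜ (t i).get ⟶ s.get i) :
    mapArrow F (s := Ctx.concat t) (prodArrow g ≫ f) =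
      prodArrow (s := s.mapObj F.obj) (t := fun i => (t i).mapObj F.obj)
        (fun i => mapArrow F (g i)) ≫ mapArrow F f := by
  refine mapArrow_eq F _ ?_
  have h : piComparison F (Ctx.concat t).get ≫ prodArrow (s := s.mapObj F.obj)
      (t := fun i => (t i).mapObj F.obj) (fun i => mapArrow F (g i)) =
      F.map (prodArrow g) ≫ piComparison F s.get := by
    refine Pi.hom_ext _ _ fun i => ?_
    refine Eq.trans ?_ (Category.assoc _ _ _).symm
    refine Eq.trans ?_ (congrArg (F.map (prodArrow g) ≫ ·) (piComparison_comp_π F s.get i).symm)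
    rw [← F.map_comp, prodArrow_π]
    refine (Category.assoc _ _ _).trans ?_
    refine (congrArg (piComparison F (Ctx.concat t).get ≫ ·) (prodArrow_π (s := s.mapObj F.obj)
      (t := fun i => (t i).mapObj F.obj) (fun i => mapArrow F (g i)) i)).trans ?_
    have h2 := piComparison_reindex F (Ctx.incl t i)
    refine (Category.assoc _ _ _).symm.trans ?_
    refine (congrArg (· ≫ mapArrow F (g i)) h2).trans ?_
    rw [Category.assoc, piComparison_mapArrow, F.map_comp]
  refine Eq.trans ?_ (Category.assoc _ _ _)
  refine Eq.trans ?_ (congrArg (· ≫ mapArrow F f) h.symm)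
  rw [Category.assoc, piComparison_mapArrow, F.map_comp]

lemma mapArrow_functor_id {s : Ctx C} {X : C} (f : ∏ᶜ s.get ⟶ X) : mapArrow (𝟭 C) f = f := by
  refine mapArrow_eq (𝟭 C) f ?_
  have h : piComparison (𝟭 C) s.get = 𝟙 (∏ᶜ s.get) := by
    refine Pi.hom_ext _ _ fun i => ?_
    exact (piComparison_comp_π (𝟭 C) s.get i).trans (Category.id_comp _).symm
  rw [h]
  exact (Category.id_comp _).symm

lemma mapArrow_functor_comp {s : Ctx C} {X : C} (f : ∏ᶜ s.get ⟶ X) :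
    mapArrow (F ⋙ G) f = mapArrow G (mapArrow F f) := by
  refine mapArrow_eq (F ⋙ G) f ?_
  have h : piComparison (F ⋙ G) s.get =
      G.map (piComparison F s.get) ≫ piComparison G (s.mapObj F.obj).get := by
    refine Pi.hom_ext _ _ fun i => ?_
    refine (piComparison_comp_π (F ⋙ G) s.get i).trans ?_
    refine Eq.trans ?_ (Category.assoc _ _ _).symm
    refine Eq.trans ?_ (congrArg (G.map (piComparison F s.get) ≫ ·)
      (piComparison_comp_π G (s.mapObj F.obj).get i).symm)
    refine Eq.trans ?_ (G.map_comp _ _)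
    exact congrArg G.map (piComparison_comp_π F s.get i).symm
  rw [h]
  refine Eq.trans ?_ (Category.assoc _ _ _).symm
  refine Eq.trans ?_ (congrArg (G.map (piComparison F s.get) ≫ ·)
    (piComparison_mapArrow G (mapArrow F f)).symm)
  exact (congrArg G.map (piComparison_mapArrow F f).symm).trans (G.map_comp _ _)

end TimesMap

/-- The cartesian multicategory `C_×` of a finite product category `C`. -/
def timesObj (C : FPCat.{v, u}) : FpMlt.{v, u} := ⟨timesMulticategory C.carrier, timesFp C.carrier⟩

/-- The fp-functor `F_× : C_× → D_×` of a finite product preserving functor `F`. -/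
def timesMap {C D : FPCat.{v, u}} (F : C ⟶ D) : timesObj C ⟶ timesObj D :=
  haveI := F.preserves
  { obj := F.functor.obj
    map := fun f => mapArrow F.functor f
    map_id := mapArrow_id F.functor
    map_comp := fun f _ g => mapArrow_comp F.functor f g
    map_act := fun p _ f => mapArrow_reindex F.functor p f }

/-- The functor `(-)_× : Cat^× → fpRep`. -/
def times : FPCat.{v, u} ⥤ FpRep.{v, u} where
  obj C := ⟨timesObj C, timesMulticategory_isRepresentable C.carrier⟩
  map F := ObjectProperty.homMk (timesMap F)
  map_id C := by
    apply ObjectProperty.hom_ext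
    refine FpMlt.Hom.ext rfl (heq_of_eq ?_)
    funext s X f
    exact mapArrow_functor_id f
  map_comp F G := by
    have := F.preserves
    have := G.preserves
    apply ObjectProperty.hom_ext
    refine FpMlt.Hom.ext rfl (heq_of_eq ?_)
    funext s X f
    exact mapArrow_functor_comp F.functor G.functor f

end CartMulti

end

/-!
Let `φ` be an fp-structure on a multicategory `M`.  For `f : s → X` and arrows `gᵢ : t → sᵢ` with a
common source, `FpStructure.tuple` is the arrow `f(g₁ x, …, gₙ x)`, obtained from the composite
`f(g₁, …, gₙ)` by identification of variables.  An arrow `e : s → P` together with unary arrows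
`πᵢ : P → sᵢ` is a product in the equational sense (`FpStructure.IsProd`) if `πᵢ e` is the `i`-th
variable and `e(π₁ x, …, πₙ x) = x`.  These equations suffice to make `P` a product, with respect to
arrows from arbitrary sequences and hence in the underlying category, and to make composition
with `e` a bijection from the arrows `P → Z` to the arrows `s → Z`.

In a representation `(T, η)` the first equation defines `πᵢ : T s → sᵢ`, and the second one holds
because both sides agree after composition with `η s`.  So `T s` is a product.

An fp-structure is determined by its weakenings, the actions of the maps `⟨sᵢ⟩ ⟶ s`: the action on
`η s` is determined by its components, and each arrow from `s` is a unary arrow composed with `η s`.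
The weakenings are determined by representability alone (`FpStructure.act_term_eq`), since an unwanted
argument can be sent to the object `T ⟨⟩` that represents the empty sequence, and an arrow with
arguments in `T ⟨⟩` is determined by its composite with `η ⟨⟩`.

With `e s : s → ∏ s` the universal arrow to the chosen product, `g ↦ g (e s)` is an isomorphism
from the cartesian multicategory of the underlying category to `M`, with inverse
`f ↦ f(π₁ x, …, πₙ x)`; this gives essential surjectivity of `(-)_×`.  Finally an fp-functor
`H : C_× → D_×` restricts to a functor `C ⥤ D` on unary arrows.  As `H` preserves tuples and
projections, the image under `H` of the identity of `∏ s`, viewed as an arrow `s → ∏ s`, is inverse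
to the comparison arrow of that functor.  Hence the functor preserves finite products and `H` is
recovered from it, so that `(-)_×` is full and faithful.
-/

noncomputable section

namespace CartMulti

/-! ### Maps out of a concatenation -/

namespace Ctx

variable {O : Type u}

/-- In `N / O` a concatenation is a coproduct of its blocks; this is the uniqueness half. -/
lemma concat_hom_ext {n : ℕ} {t : Fin n → Ctx O} {r : Ctx O} {p q : concat t ⟶ r}
    (h : ∀ i, incl t i ≫ p = incl t i ≫ q) : p = q := by
  refine Map.ext (funext fun k => ?_)
  obtain ⟨⟨i, j⟩, rfl⟩ := (pos t).surjective k
  exact congrFun (congrArg Map.fn (h i)) j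

/-- The codiagonal: it maps each block of the concatenation of `n` copies of `t` identically
onto `t`. -/
def fold (n : ℕ) (t : Ctx O) : concat (fun _ : Fin n => t) ⟶ t where
  fn k := ((pos fun _ : Fin n => t).symm k).2
  get_fn _ := rfl

@[simp]
lemma incl_fold {n : ℕ} (t : Ctx O) (i : Fin n) : incl (fun _ : Fin n => t) i ≫ fold n t = 𝟙 t := by
  refine Map.ext (funext fun j => ?_)
  change ((pos fun _ : Fin n => t).symm (pos (fun _ : Fin n => t) ⟨i, j⟩)).2 = j
  rw [Equiv.symm_apply_apply]

@[simp]
lemma incl_fold_assoc {n : ℕ} (t : Ctx O) (i : Fin n) {r : Ctx O} (q : t ⟶ r) :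
    incl (fun _ : Fin n => t) i ≫ fold n t ≫ q = q := by
  rw [← Category.assoc, incl_fold, Category.id_comp]

lemma incl_sumMap_assoc {n : ℕ} {t t' : Fin n → Ctx O} (p : ∀ i, t i ⟶ t' i) (i : Fin n)
    {r : Ctx O} (q : concat t' ⟶ r) : incl t i ≫ sumMap p ≫ q = p i ≫ incl t' i ≫ q := by
  rw [← Category.assoc, incl_sumMap, Category.assoc]

instance (s : Ctx O) (X : O) : Subsingleton (s ⟶ single X) :=
  ⟨fun _ _ => Map.ext (funext fun _ => Subsingleton.elim (α := Fin 1) _ _)⟩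

lemma sumMap_fold {n : ℕ} {t t' : Ctx O} (p : t ⟶ t') :
    sumMap (fun _ : Fin n => p) ≫ fold n t' = fold n t ≫ p :=
  concat_hom_ext fun i => by rw [incl_sumMap_assoc, incl_fold_assoc, incl_fold, Category.comp_id]

/-- Folding all copies of `s` contained in `s, …, s`, with the `i`-th copy restricted to its
`i`-th term, restores `s`. -/
lemma toSingles_sumMap_term_fold (s : Ctx O) :
    s.toSingles ≫ sumMap (fun i => s.term i) ≫ fold s.len s = 𝟙 s := by
  refine Map.ext (funext fun i => ?_)
  have h : incl (fun i => single (s.get i)) i ≫ sumMap (fun i => s.term i) ≫ fold s.len s =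
      s.term i := by
    rw [incl_sumMap_assoc, incl_fold, Category.comp_id]
  exact congrFun (congrArg Map.fn h) (0 : Fin 1)

lemma incl_blockMap_assoc {m n : ℕ} (t : Fin m → Ctx O) (p : Fin n → Fin m) (i : Fin n)
    {r : Ctx O} (q : concat t ⟶ r) :
    incl (fun i => t (p i)) i ≫ blockMap t p ≫ q = incl t (p i) ≫ q := by
  rw [← Category.assoc, incl_blockMap]

end Ctx

namespace Multicategory

/-- The case of associativity in which the outermost arrow is unary. -/
lemma comp_post (M : Multicategory.{v, u}) {s : Ctx M.Obj} {X Y : M.Obj}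
    (f : M.Hom (Ctx.single X) Y) (g : M.Hom s X) {t : Fin s.len → Ctx M.Obj}
    (h : ∀ i, M.Hom (t i) (s.get i)) : M.comp (M.post f g) h = M.post f (M.comp g h) := by
  apply eq_of_heq
  refine HEq.trans ?_ ((M.assoc (s := Ctx.single X) f (t := fun _ => s) (fun _ => g)
    (r := fun _ => t) (fun _ => h)).trans
      (M.post_heq f (M.comp g h)).symm)
  have key : ∀ (i : Fin s.len) (z : Σ _ : Fin 1, Fin s.len), z.2 = i →
      t i = t z.2 ∧ h i ≍ h z.2 := by
    rintro _ z rfl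
    exact ⟨rfl, HEq.rfl⟩
  have hz : ∀ (i : Fin s.len) (i' : Fin (Ctx.concat fun _ : Fin 1 => s).len), (i : ℕ) = i' →
      ((Ctx.pos fun _ : Fin 1 => s).symm i').2 = i := by
    intro i i' e
    obtain ⟨⟨a, b⟩, rfl⟩ := (Ctx.pos fun _ : Fin 1 => s).surjective i'
    obtain rfl : a = 0 := Subsingleton.elim _ _
    rw [Equiv.symm_apply_apply]
    rw [Ctx.pos_val] at e
    apply Fin.ext
    simpa using e.symm
  exact M.comp_congr (Ctx.concat_one s).symm (M.post_heq f g)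
    (fun i i' e => (key i _ (hz i i' e)).1) (fun i i' e => (key i _ (hz i i' e)).2)

lemma id_post (M : Multicategory.{v, u}) {s : Ctx M.Obj} {X : M.Obj} (f : M.Hom s X) :
    M.post (M.id X) f = f :=
  eq_of_heq ((M.post_heq _ _).trans (M.id_comp f))

lemma post_id (M : Multicategory.{v, u}) {X Y : M.Obj} (f : M.Hom (Ctx.single X) Y) :
    M.post f (M.id X) = f :=
  eq_of_heq ((M.post_heq _ _).trans (M.comp_id f))

end Multicategory

/-! ### The action in a cartesian multicategory -/

namespace FpStructure

variable {M : Multicategory.{v, u}} (φ : FpStructure M)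

/-- Order isomorphisms of index sets, which only rename a sequence, act trivially. -/
lemma act_heq {s t : Ctx M.Obj} (p : s ⟶ t)
    (hp : StrictMono p.fn ∧ Function.Surjective p.fn) {X : M.Obj} (f : M.Hom s X) :
    φ.act p f ≍ f := by
  obtain ⟨rfl, rfl⟩ := Ctx.eq_of_mono p hp.1 hp.2
  exact heq_of_eq (φ.act_id f)

lemma comp_unary {s : Ctx M.Obj} {X Y : M.Obj} (g : M.Hom (Ctx.single X) Y) (f : M.Hom s X) :
    M.comp (s := Ctx.single X) g (t := fun _ => s) (fun _ => f) =
      φ.act (Ctx.incl (fun _ : Fin 1 => s) 0) (M.post g f) :=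
  eq_of_heq ((M.post_heq g f).symm.trans (φ.act_heq _ (Ctx.incl_mono s) _).symm)

lemma comp_id_eq {s : Ctx M.Obj} {X : M.Obj} (f : M.Hom s X) :
    M.comp f (fun i => M.id (s.get i)) = φ.act s.toSingles f :=
  eq_of_heq ((M.comp_id f).trans (φ.act_heq _ (Ctx.toSingles_mono s) _).symm)

lemma assoc_eq {s : Ctx M.Obj} {X : M.Obj} (f : M.Hom s X) {t : Fin s.len → Ctx M.Obj}
    (g : ∀ i, M.Hom (t i) (s.get i)) {r : ∀ i, Fin (t i).len → Ctx M.Obj}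
    (h : ∀ i j, M.Hom (r i j) ((t i).get j)) :
    M.comp f (fun i => M.comp (g i) (h i)) = φ.act (Ctx.concatAssoc t r)
      (M.comp (M.comp f g) (t := fun k => r ((Ctx.pos t).symm k).1 ((Ctx.pos t).symm k).2)
        (fun k => h ((Ctx.pos t).symm k).1 ((Ctx.pos t).symm k).2)) :=
  eq_of_heq ((M.assoc f g h).symm.trans (φ.act_heq _ (Ctx.concatAssoc_mono t r) _).symm)

lemma post_eq {s : Ctx M.Obj} {X Y : M.Obj} (g : M.Hom (Ctx.single X) Y) (f : M.Hom s X) :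
    M.post g f = φ.act (Ctx.fold 1 s)
      (M.comp (s := Ctx.single X) g (t := fun _ => s) (fun _ => f)) := by
  rw [φ.comp_unary, ← φ.act_comp, Ctx.incl_fold, φ.act_id]

lemma post_act {s t : Ctx M.Obj} {X Y : M.Obj} (g : M.Hom (Ctx.single X) Y) (p : s ⟶ t)
    (f : M.Hom s X) : M.post g (φ.act p f) = φ.act p (M.post g f) := by
  rw [φ.post_eq, φ.post_eq g f, ← φ.act_comp, ← Ctx.sumMap_fold, φ.act_comp]
  exact congrArg _ (φ.comp_act (s := Ctx.single X) g (fun _ => p) (fun _ => f))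

/-- Composition with an arrow that ignores all arguments but the `i`-th. -/
lemma comp_act_term {s : Ctx M.Obj} (i : Fin s.len) {X : M.Obj}
    (f : M.Hom (Ctx.single (s.get i)) X) {t : Fin s.len → Ctx M.Obj}
    (g : ∀ j, M.Hom (t j) (s.get j)) :
    M.comp (φ.act (s.term i) f) g = φ.act (Ctx.incl t i) (M.post f (g i)) := by
  refine (φ.act_comp' (fun _ : Fin 1 => i) f g).trans ?_
  refine (congrArg (φ.act (Ctx.blockMap t fun _ : Fin 1 => i)) (φ.comp_unary f (g i))).trans ?_
  refine (φ.act_comp _ _ _).symm.trans ?_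
  exact congrArg (fun p => φ.act p (M.post f (g i)))
    (Ctx.incl_blockMap t (fun _ : Fin 1 => i) (0 : Fin 1))

/-- The arrow `x ↦ f (g₁ x, …, gₙ x)`: composition followed by identification of the variables
of `g₁, …, gₙ`. -/
def tuple {s : Ctx M.Obj} {X : M.Obj} (f : M.Hom s X) {t : Ctx M.Obj}
    (g : ∀ i, M.Hom t (s.get i)) : M.Hom t X :=
  φ.act (Ctx.fold s.len t) (M.comp f g)

lemma post_tuple {s : Ctx M.Obj} {X Y : M.Obj} (k : M.Hom (Ctx.single X) Y) (f : M.Hom s X)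
    {t : Ctx M.Obj} (g : ∀ i, M.Hom t (s.get i)) :
    M.post k (φ.tuple f g) = φ.tuple (M.post k f) g := by
  rw [tuple, φ.post_act, ← M.comp_post, tuple]

/-- Substitution in a variable. -/
lemma tuple_act_term {s : Ctx M.Obj} (i : Fin s.len) {t : Ctx M.Obj}
    (g : ∀ j, M.Hom t (s.get j)) : φ.tuple (φ.act (s.term i) (M.id _)) g = g i := by
  rw [tuple, φ.comp_act_term, ← φ.act_comp, Ctx.incl_fold, φ.act_id, M.id_post]

/-- Substitution of the variables themselves. -/
lemma tuple_terms {s : Ctx M.Obj} {X : M.Obj} (f : M.Hom s X) :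
    φ.tuple f (fun i => φ.act (s.term i) (M.id (s.get i))) = f := by
  have h := φ.comp_act f (fun i => s.term i) (fun i => M.id (s.get i))
  rw [tuple, h, φ.comp_id_eq, ← φ.act_comp, ← φ.act_comp,
    Ctx.toSingles_sumMap_term_fold, φ.act_id]

/-- Associativity of substitution, `f(g₁(h x), …, gₙ(h x)) = (f(g₁, …, gₙ))(h x)`. -/
lemma tuple_post {s : Ctx M.Obj} {X Y : M.Obj} (f : M.Hom s X)
    (g : ∀ i, M.Hom (Ctx.single Y) (s.get i)) {t : Ctx M.Obj} (h : M.Hom t Y) :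
    φ.tuple f (fun i => M.post (g i) h) = M.post (φ.tuple f g) h := by
  -- Both sides are obtained from the same composite by folding all copies of `t` into one.
  have h1 : M.comp f (fun i => M.comp (s := Ctx.single Y) (g i) (t := fun _ => t) (fun _ => h)) =
      φ.act (Ctx.sumMap fun _ : Fin s.len => Ctx.incl (fun _ : Fin 1 => t) 0)
        (M.comp f fun i => M.post (g i) h) := by
    rw [← φ.comp_act]
    exact congrArg (M.comp f) (funext fun i => φ.comp_unary (g i) h)
  have h2 := φ.assoc_eq f g (r := fun _ _ => t) (fun _ _ => h)
  have h3 : M.comp (s := Ctx.single Y) (φ.tuple f g) (t := fun _ => t) (fun _ => h) =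
      φ.act (Ctx.blockMap (fun _ : Fin 1 => t)
          (fun _ : Fin (Ctx.concat fun _ : Fin s.len => Ctx.single Y).len => (0 : Fin 1)))
        (M.comp (M.comp f g) (t := fun _ => t) (fun _ => h)) := by
    refine Eq.trans ?_ (φ.act_comp' (r := Ctx.single Y)
      (fun _ : Fin (Ctx.concat fun _ : Fin s.len => Ctx.single Y).len => (0 : Fin 1))
      (M.comp f g) (t := fun _ => t) (fun _ => h))
    have hp : Ctx.fold s.len (Ctx.single Y) = (Ctx.single Y).pullMap
      (fun _ : Fin (Ctx.concat fun _ : Fin s.len => Ctx.single Y).len => (0 : Fin 1)) :=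
      Subsingleton.elim _ _
    rw [tuple, hp]
  have h4 := h1.symm.trans h2
  rw [φ.post_eq, h3, ← φ.act_comp, tuple]
  have e1 : Ctx.fold s.len t =
      (Ctx.sumMap fun _ : Fin s.len => Ctx.incl (fun _ : Fin 1 => t) 0) ≫
        (Ctx.sumMap fun _ : Fin s.len => Ctx.fold 1 t) ≫ Ctx.fold s.len t := by
    refine Ctx.concat_hom_ext fun i => ?_
    rw [Ctx.incl_sumMap_assoc, Ctx.incl_sumMap_assoc, Ctx.incl_fold_assoc, Ctx.incl_fold]
  rw [e1, φ.act_comp, h4, ← φ.act_comp]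
  congr 1
  refine Ctx.concat_hom_ext fun k => ?_
  refine Eq.trans ?_ (Ctx.incl_blockMap_assoc (fun _ : Fin 1 => t) _ k _).symm
  rw [← Category.assoc, Ctx.incl_concatAssoc (fun _ : Fin s.len => Ctx.single Y) (fun _ _ => t),
    Category.assoc, Ctx.incl_sumMap_assoc, Ctx.incl_fold, Ctx.incl_fold, Category.comp_id,
    Ctx.incl_fold]

end FpStructure

/-! ### Products in a cartesian multicategory -/

namespace FpStructure

variable {M : Multicategory.{v, u}} (φ : FpStructure M)

/-- The equational notion of a product of the sequence `s`: an object `P` with a universal arrow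
`e : s → P` and projections `π i : P → s i`, subject to `πᵢ(e(x₁, …, xₙ)) = xᵢ` and
`e(π₁ x, …, πₙ x) = x`. -/
structure IsProd {s : Ctx M.Obj} {P : M.Obj} (e : M.Hom s P)
    (π : ∀ i, M.Hom (Ctx.single P) (s.get i)) : Prop where
  post_proj : ∀ i, M.post (π i) e = φ.act (s.term i) (M.id (s.get i))
  tuple_proj : φ.tuple e π = M.id P

namespace IsProd

variable {φ} {s : Ctx M.Obj} {P : M.Obj} {e : M.Hom s P}
  {π : ∀ i, M.Hom (Ctx.single P) (s.get i)}

lemma post_tuple (h : φ.IsProd e π) {t : Ctx M.Obj} (f : ∀ i, M.Hom t (s.get i))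
    (i : Fin s.len) : M.post (π i) (φ.tuple e f) = f i := by
  rw [φ.post_tuple, h.post_proj, φ.tuple_act_term]

lemma hom_ext (h : φ.IsProd e π) {t : Ctx M.Obj} {f f' : M.Hom t P}
    (hf : ∀ i, M.post (π i) f = M.post (π i) f') : f = f' := by
  have key : ∀ f : M.Hom t P, φ.tuple e (fun i => M.post (π i) f) = f := fun f => by
    rw [φ.tuple_post, h.tuple_proj, M.id_post]
  rw [← key f, ← key f', funext hf]

lemma tuple_post (h : φ.IsProd e π) {Z : M.Obj} (k : M.Hom (Ctx.single P) Z) :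
    φ.tuple (M.post k e) π = k := by
  rw [← φ.post_tuple, h.tuple_proj, M.post_id]

lemma post_tuple_proj (h : φ.IsProd e π) {Z : M.Obj} (f : M.Hom s Z) :
    M.post (φ.tuple f π) e = f := by
  rw [← φ.tuple_post, funext h.post_proj, φ.tuple_terms]

lemma post_injective (h : φ.IsProd e π) {Z : M.Obj} :
    Function.Injective fun k : M.Hom (Ctx.single P) Z => M.post k e := fun k k' hk => by
  rw [← h.tuple_post k, ← h.tuple_post k']
  exact congrArg (fun f => φ.tuple f π) hk

/-- A product in the equational sense is a product in the underlying category. -/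
def isLimit (h : φ.IsProd e π) : IsLimit (Fan.mk (C := M.Underlying) (f := s.get) P π) :=
  Fan.IsLimit.mk _ (fun c => φ.tuple e fun i => c.proj i)
    (fun c i => h.post_tuple (fun i => c.proj i) i)
    (fun c _ hm => h.hom_ext fun i => (hm i).trans (h.post_tuple (fun i => c.proj i) i).symm)

end IsProd

end FpStructure

/-! ### Representations give products -/

namespace Multicategory.IsRepresentation

variable {M : Multicategory.{v, u}} {T : Ctx M.Obj → M.Obj} {η : ∀ s, M.Hom s (T s)}

lemma post_bijective (hR : M.IsRepresentation T η) (s : Ctx M.Obj) (Z : M.Obj) :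
    Function.Bijective fun f : M.Hom (Ctx.single (T s)) Z => M.post f (η s) :=
  (Equiv.bijective (Equiv.cast (congrArg (fun r => M.Hom r Z) (Ctx.concat_one s)))).comp
    (hR 1 (fun _ => s) Z)

/-- For the projections `πᵢ` with `πᵢ η = termᵢ`, the equation `η(π₁, …, πₙ) = id` holds because
it holds after composition with `η`. -/
lemma isProd (hR : M.IsRepresentation T η) (φ : FpStructure M) {s : Ctx M.Obj}
    {π : ∀ i, M.Hom (Ctx.single (T s)) (s.get i)}
    (hπ : ∀ i, M.post (π i) (η s) = φ.act (s.term i) (M.id (s.get i))) :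
    φ.IsProd (η s) π where
  post_proj := hπ
  tuple_proj := (hR.post_bijective s (T s)).1 <| by
    change M.post (φ.tuple (η s) π) (η s) = M.post (M.id (T s)) (η s)
    rw [← φ.tuple_post, funext hπ, φ.tuple_terms, M.id_post]

lemma exists_proj (hR : M.IsRepresentation T η) (φ : FpStructure M) (s : Ctx M.Obj) :
    ∃ π : ∀ i, M.Hom (Ctx.single (T s)) (s.get i),
      ∀ i, M.post (π i) (η s) = φ.act (s.term i) (M.id (s.get i)) :=
  ⟨fun _ => ((hR.post_bijective s _).2 _).choose,
    fun _ => ((hR.post_bijective s _).2 _).choose_spec⟩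

end Multicategory.IsRepresentation

/-! ### Uniqueness of the fp-structure -/

namespace FpStructure

variable {M : Multicategory.{v, u}} {T : Ctx M.Obj → M.Obj} {η : ∀ s, M.Hom s (T s)}

/-- In a representable multicategory the weakenings do not depend on the fp-structure.  Let `b j`
be empty for `j ≠ i` and `⟨s i⟩` for `j = i`.  The weakening of `id` to the sequence of the
objects `T (b j)` is determined by its composite with the arrows `η (b j)`, in which nothing is
left to weaken; substitution of arrows `s j → T (b j)` then gives the weakening to `s`. -/
lemma act_term_eq (hR : M.IsRepresentation T η) (φ ψ : FpStructure M) (s : Ctx M.Obj)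
    (i : Fin s.len) {X : M.Obj} (f : M.Hom (Ctx.single (s.get i)) X) :
    φ.act (s.term i) f = ψ.act (s.term i) f := by
  let b : Fin s.len → Ctx M.Obj := fun j => ⟨if j = i then 1 else 0, fun _ => s.get j⟩
  let q : ∀ j, b j ⟶ Ctx.single (s.get j) := fun j => ⟨fun _ => (0 : Fin 1), fun _ => rfl⟩
  let q' : Ctx.single (s.get i) ⟶ b i := ⟨fun _ => ⟨0, by simp [b]⟩, fun _ => rfl⟩
  let r : Ctx M.Obj := ⟨s.len, fun j => T (b j)⟩
  let g : ∀ j, M.Hom (Ctx.single (s.get j)) (T (b j)) := fun j => φ.act (q j) (η (b j))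
  have hb : StrictMono (Ctx.incl b i).fn ∧ Function.Surjective (Ctx.incl b i).fn := by
    refine ⟨fun j j' h => Ctx.pos_lt_of_snd b h, fun k => ?_⟩
    obtain ⟨⟨i', j⟩, rfl⟩ := (Ctx.pos b).surjective k
    have hi : i' = i := by
      by_contra hne
      have := j.2
      simp [b, hne] at this
    subst hi
    exact ⟨j, rfl⟩
  have h1 : φ.act (r.term i) (M.id (T (b i))) = ψ.act (r.term i) (M.id (T (b i))) := by
    refine (hR s.len b (T (b i))).1 ?_
    refine (φ.comp_act_term (s := r) i _ (t := b) (fun j => η (b j))).trans ?_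
    refine Eq.trans ?_ (ψ.comp_act_term (s := r) i _ (t := b) (fun j => η (b j))).symm
    exact eq_of_heq ((φ.act_heq _ hb _).trans (ψ.act_heq _ hb _).symm)
  have h2 : φ.act (s.term i) (g i) = ψ.act (s.term i) (g i) := by
    have h3 := φ.comp_act_term (s := r) i (M.id (T (b i))) g
    rw [h1, ψ.comp_act_term (s := r) i (M.id (T (b i))) g, M.id_post] at h3
    have h4 : Ctx.incl (fun j => Ctx.single (s.get j)) i = s.term i ≫ s.toSingles :=
      Ctx.Map.ext (funext fun j => congrArg
        (fun j : Fin 1 => Ctx.pos (fun j => Ctx.single (s.get j)) ⟨i, j⟩)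
        (Subsingleton.elim (α := Fin 1) j 0))
    change ψ.act (Ctx.incl (fun j => Ctx.single (s.get j)) i) (g i) =
      φ.act (Ctx.incl (fun j => Ctx.single (s.get j)) i) (g i) at h3
    rw [h4, φ.act_comp, ψ.act_comp] at h3
    exact eq_of_heq ((φ.act_heq _ s.toSingles_mono _).symm.trans
      ((heq_of_eq h3.symm).trans (ψ.act_heq _ s.toSingles_mono _)))
  obtain ⟨k, hk⟩ := (hR.post_bijective (b i) X).2 (φ.act q' f)
  have hkg : M.post k (g i) = f := by
    change M.post k (φ.act (q i) (η (b i))) = f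
    rw [φ.post_act]
    refine (congrArg (φ.act (q i)) hk).trans ?_
    rw [← φ.act_comp, Subsingleton.elim (q' ≫ q i) (𝟙 _), φ.act_id]
  rw [← hkg, ← φ.post_act, ← ψ.post_act, h2]

/-- Each map from a one-term sequence is the inclusion of a term. -/
lemma act_single_eq (hR : M.IsRepresentation T η) (φ ψ : FpStructure M) {s : Ctx M.Obj}
    {Y X : M.Obj} (p : Ctx.single Y ⟶ s) (f : M.Hom (Ctx.single Y) X) :
    φ.act p f = ψ.act p f := by
  have key : ∀ (k : Fin s.len) (Y : M.Obj) (e : s.get k = Y) (f : M.Hom (Ctx.single Y) X),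
      φ.act (show Ctx.single Y ⟶ s from ⟨fun _ => k, fun _ => e⟩) f =
        ψ.act (show Ctx.single Y ⟶ s from ⟨fun _ => k, fun _ => e⟩) f := by
    rintro k _ rfl f
    exact act_term_eq hR φ ψ s k f
  have hp : p = (show Ctx.single Y ⟶ s from
      ⟨fun _ => p.fn (0 : Fin 1), fun _ => p.get_fn (0 : Fin 1)⟩) :=
    Ctx.Map.ext (funext fun j => congrArg p.fn (Subsingleton.elim (α := Fin 1) j 0))
  rw [hp]
  exact key _ Y _ f

lemma subsingleton (hR : M.IsRepresentation T η) : Subsingleton (FpStructure M) := by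
  refine ⟨fun φ ψ => ?_⟩
  have key : ∀ {s t : Ctx M.Obj} (p : s ⟶ t) {X : M.Obj} (f : M.Hom s X),
      φ.act p f = ψ.act p f := by
    intro s t p X f
    obtain ⟨π, hπ⟩ := hR.exists_proj φ s
    -- It suffices to compare the actions on `η s`, which is done componentwise.
    have hη : φ.act p (η s) = ψ.act p (η s) := by
      refine (hR.isProd φ hπ).hom_ext fun i => ?_
      rw [φ.post_act, ψ.post_act, hπ, ← φ.act_comp, act_single_eq hR φ ψ (s.term i),
        ← ψ.act_comp, act_single_eq hR φ ψ]
    obtain ⟨k, rfl⟩ := (hR.post_bijective s X).2 f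
    change φ.act p (M.post k (η s)) = ψ.act p (M.post k (η s))
    rw [← φ.post_act, ← ψ.post_act, hη]
  exact FpStructure.ext (by funext s t p X f; exact key p f)

end FpStructure

/-! ### Comparison with the cartesian multicategory of the underlying category -/

section Underlying

variable {M : Multicategory.{v, u}}

lemma hasFiniteProducts_underlying (φ : FpStructure M) (hM : M.IsRepresentable) :
    HasFiniteProducts M.Underlying := by
  obtain ⟨T, η, hR⟩ := hM
  refine ⟨fun n => ⟨fun K => ?_⟩⟩
  let s : Ctx M.Obj := ⟨n, fun i => K.obj ⟨i⟩⟩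
  obtain ⟨π, hπ⟩ := hR.exists_proj φ s
  have : HasLimit (Discrete.functor (C := M.Underlying) s.get) :=
    ⟨⟨_, (hR.isProd φ hπ).isLimit⟩⟩
  exact hasLimit_of_iso (F := Discrete.functor (C := M.Underlying) s.get)
    (Discrete.natIso fun _ => Iso.refl _)

lemma act_term_post_eqToHom (φ : FpStructure M) {t : Ctx M.Obj} (k : Fin t.len) {X : M.Obj}
    (h : t.get k = X) :
    φ.act (t.term k) (M.post (eqToHom (C := M.Underlying) h) (M.id (t.get k))) =
      φ.act (show Ctx.single X ⟶ t from ⟨fun _ => k, fun _ => h⟩) (M.id X) := by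
  subst h
  exact congrArg (φ.act (t.term k)) (M.id_post _)

variable [HasFiniteProducts M.Underlying]

/-- The chosen product of `s` in the underlying category. -/
def underlyingProd (s : Ctx M.Obj) : M.Obj :=
  (∏ᶜ (s.get : Fin s.len → M.Underlying) : M.Underlying)

/-- The projections of the chosen product of `s` in the underlying category, as arrows of `M`. -/
def underlyingProj (s : Ctx M.Obj) (i : Fin s.len) :
    M.Hom (Ctx.single (underlyingProd s)) (s.get i) :=
  Pi.π (C := M.Underlying) s.get i

/-- Each sequence has a universal arrow to its chosen product, obtained from `η s` and the
comparison of `T s` with the chosen product. -/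
lemma exists_isProd_underlyingProj (φ : FpStructure M) (hM : M.IsRepresentable)
    (s : Ctx M.Obj) : ∃ e : M.Hom s (underlyingProd s), φ.IsProd e (underlyingProj s) := by
  obtain ⟨T, η, hR⟩ := hM
  obtain ⟨π, hπ⟩ := hR.exists_proj φ s
  have h := hR.isProd φ hπ
  let l : M.Hom (Ctx.single (T s)) (underlyingProd s) :=
    Pi.lift (C := M.Underlying) (P := T s) (f := s.get) π
  have hl : ∀ i, M.post (underlyingProj s i) l = π i := fun i =>
    Pi.lift_π (C := M.Underlying) (P := T s) (f := s.get) π i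
  have he : ∀ i, M.post (underlyingProj s i) (M.post l (η s)) =
      φ.act (s.term i) (M.id (s.get i)) := fun i => by
    rw [M.post_post, hl, hπ]
  refine ⟨M.post l (η s), he, ?_⟩
  refine Pi.hom_ext (C := M.Underlying) (f := s.get) _ _ fun i => ?_
  change M.post (underlyingProj s i) _ = M.post (underlyingProj s i) (M.id _)
  rw [φ.post_tuple, he, φ.tuple_act_term, M.post_id]

/-- The arrow between chosen products given by `p : s ⟶ t`, as an arrow of `M`. -/
def underlyingReindex {s t : Ctx M.Obj} (p : s ⟶ t) :
    M.Hom (Ctx.single (underlyingProd t)) (underlyingProd s) :=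
  reindex (C := M.Underlying) p

/-- The product of the arrows `g i`, from the chosen product of the concatenation, as an arrow
of `M`. -/
def underlyingProdArrow {s : Ctx M.Obj} {t : Fin s.len → Ctx M.Obj}
    (g : ∀ i, M.Hom (Ctx.single (underlyingProd (t i))) (s.get i)) :
    M.Hom (Ctx.single (underlyingProd (Ctx.concat t))) (underlyingProd s) :=
  prodArrow (C := M.Underlying) (s := s) (t := t) g

variable {φ : FpStructure M} {e : ∀ s : Ctx M.Obj, M.Hom s (underlyingProd s)}

/-- Under the universal arrows, diagonals and projections correspond to the action. -/
lemma post_reindex (he : ∀ s, φ.IsProd (e s) (underlyingProj s)) {s t : Ctx M.Obj} (p : s ⟶ t) :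
    M.post (underlyingReindex p) (e t) = φ.act p (e s) := by
  refine (he s).hom_ext fun i => ?_
  rw [φ.post_act, (he s).post_proj, ← φ.act_comp, M.post_post]
  have h1 : M.post (underlyingProj s i) (underlyingReindex p) =
      M.post (eqToHom (C := M.Underlying) (p.get_fn i)) (underlyingProj t (p.fn i)) :=
    reindex_π (C := M.Underlying) p i
  rw [h1, ← M.post_post, (he t).post_proj, φ.post_act, act_term_post_eqToHom]
  rfl

lemma post_prodArrow (he : ∀ s, φ.IsProd (e s) (underlyingProj s)) {s : Ctx M.Obj}
    {t : Fin s.len → Ctx M.Obj} (g : ∀ i, M.Hom (Ctx.single (underlyingProd (t i))) (s.get i)) :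
    M.post (underlyingProdArrow g) (e (Ctx.concat t)) =
      M.comp (e s) (fun i => M.post (g i) (e (t i))) := by
  refine (he s).hom_ext fun i => ?_
  rw [M.post_post, ← M.comp_post, (he s).post_proj, φ.comp_act_term, M.id_post]
  have h1 : M.post (underlyingProj s i) (underlyingProdArrow g) =
      M.post (g i) (underlyingReindex (Ctx.incl t i)) :=
    prodArrow_π (C := M.Underlying) (s := s) (t := t) g i
  rw [h1, ← M.post_post, post_reindex he, φ.post_act]

/-- The comparison from the cartesian multicategory of the underlying category of `M` to `M`:
composition with the universal arrows `e s` from sequences to their products. -/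
def fromTimes (he : ∀ s, φ.IsProd (e s) (underlyingProj s)) :
    timesObj ⟨M.Underlying⟩ ⟶ (⟨M, φ⟩ : FpMlt.{v, u}) where
  obj X := X
  map {s X} g := M.post (X := underlyingProd s) (Y := X) g (e s)
  map_id X := ((he (Ctx.single X)).post_proj (0 : Fin 1)).trans <|
    (congrArg (fun p => φ.act p (M.id X)) (Subsingleton.elim _ (𝟙 (Ctx.single X)))).trans
      (φ.act_id _)
  map_comp {s X} f t g :=
    (M.post_post (X := underlyingProd (Ctx.concat (O := M.Obj) t)) (Y := underlyingProd s) (Z := X)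
      f (underlyingProdArrow (M := M) g) (e (Ctx.concat (O := M.Obj) t))).symm.trans <|
    (congrArg (M.post (X := underlyingProd s) (Y := X) f) (post_prodArrow he g)).trans <|
    (M.comp_post (X := underlyingProd s) (Y := X) f (e s) _).symm
  map_act {s t} p X f :=
    (M.post_post (X := underlyingProd (M := M) t) (Y := underlyingProd (M := M) s) (Z := X)
      f (underlyingReindex (M := M) (s := s) (t := t) p) (e t)).symm.trans <|
    (congrArg (M.post (X := underlyingProd s) (Y := X) f) (post_reindex he p)).trans <|
    φ.post_act (X := underlyingProd s) (Y := X) f p (e s)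

/-- The inverse of `fromTimes`: the arrow `f : s → X` is sent to `f (π₁ x, …, πₙ x)`. -/
def toTimes (he : ∀ s, φ.IsProd (e s) (underlyingProj s)) :
    (⟨M, φ⟩ : FpMlt.{v, u}) ⟶ timesObj ⟨M.Underlying⟩ where
  obj X := X
  map {s _} f := φ.tuple f (underlyingProj s)
  map_id X := (he (Ctx.single X)).post_injective <|
    ((he (Ctx.single X)).post_tuple_proj (M.id X)).trans ((fromTimes he).map_id X).symm
  map_comp {s X} f t g := (he (Ctx.concat t)).post_injective <| by
    refine ((he (Ctx.concat t)).post_tuple_proj (M.comp f g)).trans ?_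
    refine Eq.trans ?_ ((fromTimes he).map_comp (s := s) (X := X)
      (φ.tuple f (underlyingProj s)) (t := t)
      (fun i => φ.tuple (g i) (underlyingProj (t i)))).symm
    change _ = M.comp (M.post (φ.tuple f (underlyingProj s)) (e s))
      (fun i => M.post (φ.tuple (g i) (underlyingProj (t i))) (e (t i)))
    rw [(he s).post_tuple_proj, funext fun i => (he (t i)).post_tuple_proj (g i)]
  map_act {s t} p X f := (he t).post_injective <| by
    refine ((he t).post_tuple_proj (φ.act p f)).trans ?_
    refine Eq.trans ?_ ((fromTimes he).map_act (s := s) (t := t) p (X := X)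
      (φ.tuple f (underlyingProj s))).symm
    change _ = φ.act p (M.post (φ.tuple f (underlyingProj s)) (e s))
    rw [(he s).post_tuple_proj]

lemma nonempty_iso_timesObj (φ : FpStructure M) (hM : M.IsRepresentable) :
    Nonempty ((⟨M, φ⟩ : FpMlt.{v, u}) ≅ timesObj ⟨M.Underlying⟩) := by
  choose e he using exists_isProd_underlyingProj φ hM
  refine ⟨⟨toTimes he, fromTimes he, ?_, ?_⟩⟩
  · refine FpMlt.Hom.ext rfl (heq_of_eq ?_)
    funext s X f
    exact (he s).post_tuple_proj f
  · refine FpMlt.Hom.ext rfl (heq_of_eq ?_)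
    funext s X f
    exact (he s).tuple_post f

end Underlying

/-! ### Full faithfulness -/

/-- In `C_×` the tuple of arrows is the induced arrow to the product. -/
lemma reindex_fold_prodArrow {C : Type u} [Category.{v} C] [HasFiniteProducts C] {s t : Ctx C}
    (g : ∀ i, ∏ᶜ t.get ⟶ s.get i) :
    reindex (Ctx.fold s.len t) ≫ prodArrow (s := s) (t := fun _ => t) g = Pi.lift g := by
  refine Pi.hom_ext _ _ fun i => ?_
  rw [Category.assoc, prodArrow_π, ← Category.assoc, ← reindex_comp, Ctx.incl_fold, reindex_id,
    Category.id_comp, Pi.lift_π]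

lemma lift_id_π {C : Type u} [Category.{v} C] [HasFiniteProducts C] (X : C) :
    Pi.lift (fun _ : Fin 1 => 𝟙 X) ≫ Pi.π (fun _ : Fin 1 => X) 0 = 𝟙 X :=
  Pi.lift_π _ _

section

variable {C D : FPCat.{v, u}} (H : timesObj C ⟶ timesObj D)

/-- The action of an fp-functor `C_× → D_×` on objects. -/
abbrev onObj (X : C.carrier) : D.carrier := H.obj X

/-- The action of an fp-functor `C_× → D_×` on arrows out of products. -/
def onArrow {s : Ctx C.carrier} {X : C.carrier} (f : ∏ᶜ s.get ⟶ X) :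
    ∏ᶜ (fun i => onObj H (s.get i)) ⟶ onObj H X :=
  H.map (s := s) (X := X) f

/-- An fp-functor preserves tuples, since these are defined by composition and action. -/
lemma onArrow_lift {s t : Ctx C.carrier} {X : C.carrier} (f : ∏ᶜ s.get ⟶ X)
    (g : ∀ i, ∏ᶜ t.get ⟶ s.get i) :
    onArrow H (Pi.lift g ≫ f) =
      Pi.lift (fun i => onArrow H (g i)) ≫ onArrow H f := by
  rw [← reindex_fold_prodArrow, Category.assoc]
  refine (H.map_act (Ctx.fold s.len t) _).trans ?_
  refine (congrArg ((timesObj D).fp.act _) (H.map_comp (s := s) (X := X) f g)).trans ?_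
  have h := reindex_fold_prodArrow (s := (s.mapObj (onObj H)))
    (t := (t.mapObj (onObj H))) (fun i => onArrow H (g i))
  exact (Category.assoc _ _ _).symm.trans (congrArg (· ≫ onArrow H f) h)

lemma onArrow_π (s : Ctx C.carrier) (i : Fin s.len) :
    onArrow H (Pi.π s.get i) = Pi.π (fun i => onObj H (s.get i)) i := by
  have h1 : Pi.π s.get i =
      reindex (s.term i) ≫ Pi.π (fun _ : Fin 1 => s.get i) (0 : Fin 1) :=
    ((reindex_π (s.term i) (0 : Fin 1)).trans (Category.comp_id _)).symm
  rw [h1]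
  refine (H.map_act (s.term i) _).trans ?_
  refine (congrArg ((timesObj D).fp.act _) (H.map_id (s.get i))).trans ?_
  exact (reindex_π (C := D.carrier) (Ctx.Map.mapObj (onObj H) (s.term i)) (0 : Fin 1)).trans
    (Category.comp_id _)

/-- The action of an fp-functor `C_× → D_×` on the arrows of `C`, which are identified with the
unary arrows of `C_×`. -/
def onUnary {X Y : C.carrier} (f : X ⟶ Y) : onObj H X ⟶ onObj H Y :=
  Pi.lift (fun _ : Fin 1 => 𝟙 onObj H X) ≫
    onArrow H (s := Ctx.single X) (Pi.π (fun _ : Fin 1 => X) 0 ≫ f)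

lemma onArrow_comp {s : Ctx C.carrier} {X Y : C.carrier} (f : ∏ᶜ s.get ⟶ X) (g : X ⟶ Y) :
    onArrow H (f ≫ g) = onArrow H f ≫ onUnary H g := by
  have h1 : f ≫ g = Pi.lift (fun _ : Fin 1 => f) ≫ Pi.π (fun _ : Fin 1 => X) 0 ≫ g := by
    rw [← Category.assoc, Pi.lift_π]
  rw [h1, onUnary]
  refine (onArrow_lift H (s := Ctx.single X) (Pi.π (fun _ : Fin 1 => X) 0 ≫ g)
    (fun _ => f)).trans ?_
  rw [← Category.assoc (onArrow H f)]
  congr 1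
  refine Pi.hom_ext _ _ fun i => ?_
  rw [Category.assoc, Pi.lift_π, Pi.lift_π]
  exact (Category.comp_id (onArrow H f)).symm

/-- The functor `C ⥤ D` underlying an fp-functor `C_× → D_×`. -/
def underlyingFunctor : C.carrier ⥤ D.carrier where
  obj := onObj H
  map f := onUnary H f
  map_id X := by
    rw [onUnary, Category.comp_id]
    exact (congrArg (Pi.lift (fun _ : Fin 1 => 𝟙 onObj H X) ≫ ·)
      (onArrow_π H (Ctx.single X) (0 : Fin 1))).trans (lift_id_π _)
  map_comp {X Y Z} f g := by
    rw [onUnary, ← Category.assoc (Pi.π _ _), onArrow_comp H (s := Ctx.single X),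
      ← Category.assoc, ← onUnary]

/-- The comparison arrow from the image of a product to the product of the images. -/
def comparison (s : Ctx C.carrier) :
    onObj H (∏ᶜ s.get) ⟶ ∏ᶜ (fun i => onObj H (s.get i)) :=
  Pi.lift fun i => onUnary H (Pi.π s.get i)

lemma comparison_π (s : Ctx C.carrier) (i : Fin s.len) :
    comparison H s ≫ Pi.π (fun i => onObj H (s.get i)) i = onUnary H (Pi.π s.get i) :=
  Pi.lift_π _ _

lemma onArrow_id_comparison (s : Ctx C.carrier) :
    onArrow H (𝟙 (∏ᶜ s.get)) ≫ comparison H s = 𝟙 _ := by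
  refine Pi.hom_ext _ _ fun i => ?_
  rw [Category.assoc, comparison_π, ← onArrow_comp, Category.id_comp, onArrow_π, Category.id_comp]

lemma comparison_onArrow_id (s : Ctx C.carrier) :
    comparison H s ≫ onArrow H (𝟙 (∏ᶜ s.get)) = 𝟙 _ := by
  -- The identity of `∏ s` is the tuple of the projections, and `H` preserves tuples.
  let P : C.carrier := ∏ᶜ s.get
  let π₀ : ∏ᶜ (Ctx.single P).get ⟶ P := Pi.π (fun _ : Fin 1 => P) 0
  let ρ₀ : ∏ᶜ (fun _ : Fin 1 => onObj H P) ⟶ onObj H P := Pi.π (fun _ : Fin 1 => onObj H P) 0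
  let δ : onObj H P ⟶ ∏ᶜ (fun _ : Fin 1 => onObj H P) := Pi.lift fun _ => 𝟙 (onObj H P)
  have h1 : Pi.lift (fun i => π₀ ≫ Pi.π s.get i) ≫ 𝟙 P = π₀ := by
    refine Pi.hom_ext _ _ fun i => ?_
    rw [Category.comp_id, Pi.lift_π]
  have h2 := onArrow_lift H (t := Ctx.single P) (𝟙 P) (fun i => π₀ ≫ Pi.π s.get i)
  have h3 : onArrow H π₀ = ρ₀ := onArrow_π H (Ctx.single P) (0 : Fin 1)
  have h4 : Pi.lift (fun i => onArrow H (π₀ ≫ Pi.π s.get i)) = ρ₀ ≫ comparison H s := by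
    refine Pi.hom_ext _ _ fun i => ?_
    rw [Pi.lift_π, onArrow_comp, h3, Category.assoc, comparison_π]
  have h5 : δ ≫ ρ₀ = 𝟙 _ := lift_id_π _
  rw [h1, h3, h4] at h2
  calc comparison H s ≫ onArrow H (𝟙 P)
      = (δ ≫ ρ₀) ≫ comparison H s ≫ onArrow H (𝟙 P) := by rw [h5, Category.id_comp]
    _ = δ ≫ (ρ₀ ≫ comparison H s) ≫ onArrow H (𝟙 P) := by simp only [Category.assoc]
    _ = δ ≫ ρ₀ := congrArg (δ ≫ ·) h2.symm
    _ = 𝟙 _ := h5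

lemma preservesFiniteProducts_underlyingFunctor :
    PreservesFiniteProducts (underlyingFunctor H) := by
  refine ⟨fun n => ⟨fun {K} => ?_⟩⟩
  let s : Ctx C.carrier := ⟨n, fun i => K.obj ⟨i⟩⟩
  have : IsIso (piComparison (underlyingFunctor H) s.get) :=
    ⟨_, comparison_onArrow_id H s, onArrow_id_comparison H s⟩
  have := PreservesProduct.of_iso_comparison (underlyingFunctor H) s.get
  exact preservesLimit_of_iso_diagram (K₁ := Discrete.functor s.get) _
    (Discrete.natIso fun _ => Iso.refl _)

/-- The finite product preserving functor underlying an fp-functor `C_× → D_×`. -/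
def underlyingHom : C ⟶ D := ⟨underlyingFunctor H, preservesFiniteProducts_underlyingFunctor H⟩

lemma timesMap_underlyingHom : timesMap (underlyingHom H) = H := by
  have := preservesFiniteProducts_underlyingFunctor H
  have key : ∀ {s : Ctx C.carrier} {X : C.carrier} (f : ∏ᶜ s.get ⟶ X),
      mapArrow (underlyingFunctor H) f = onArrow H f := by
    intro s X f
    refine mapArrow_eq (underlyingFunctor H) f ?_
    change onUnary H f = comparison H s ≫ onArrow H f
    have h : onArrow H f = onArrow H (𝟙 (∏ᶜ s.get)) ≫ onUnary H f := by
      rw [← onArrow_comp, Category.id_comp]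
    rw [h, ← Category.assoc, comparison_onArrow_id, Category.id_comp]
  refine FpMlt.Hom.ext rfl (heq_of_eq ?_)
  funext s X f
  exact key f

end

lemma underlyingHom_timesMap {C D : FPCat.{v, u}} (F : C ⟶ D) :
    underlyingHom (timesMap F) = F := by
  have := F.preserves
  refine FPCat.Hom.ext (CategoryTheory.Functor.hext (fun _ => rfl) fun X Y f => heq_of_eq ?_)
  have h : mapArrow F.functor (s := Ctx.single X) (Pi.π (fun _ : Fin 1 => X) 0 ≫ f) =
      Pi.π (fun _ : Fin 1 => F.functor.obj X) 0 ≫ F.functor.map f := by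
    refine mapArrow_eq F.functor _ ?_
    rw [F.functor.map_comp, ← Category.assoc, ← piComparison_comp_π]
  refine (congrArg (Pi.lift (fun _ : Fin 1 => 𝟙 (F.functor.obj X)) ≫ ·) h).trans ?_
  exact (Category.assoc _ _ _).symm.trans
    ((congrArg (· ≫ F.functor.map f) (lift_id_π _)).trans (Category.id_comp _))

lemma times_isEquivalence : (times.{v, u}).IsEquivalence where
  faithful := ⟨fun {C D} F G h => by
    rw [← underlyingHom_timesMap F, ← underlyingHom_timesMap G]
    exact congrArg underlyingHom (congrArg (fun f => f.hom) h)⟩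
  full := ⟨fun {C D} H => ⟨underlyingHom H.hom, by
    apply ObjectProperty.hom_ext
    exact timesMap_underlyingHom H.hom⟩⟩
  essSurj := ⟨fun ⟨⟨M, φ⟩, hM⟩ => by
    have := hasFiniteProducts_underlying φ hM
    obtain ⟨i⟩ := nonempty_iso_timesObj φ hM
    exact ⟨⟨M.Underlying⟩, ⟨ObjectProperty.isoMk _ i.symm⟩⟩⟩

end CartMulti

end

theorem mainTheorem4 :
    (CartMulti.times.{v, u} : CartMulti.FPCat.{v, u} ⥤ CartMulti.FpRep.{v, u}).IsEquivalence ∧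
    ∀ M : CartMulti.Multicategory.{v, u}, M.IsRepresentable →
      Subsingleton (CartMulti.FpStructure M) ∧
      ∀ φ : CartMulti.FpStructure M,
        (∀ (T : CartMulti.Ctx M.Obj → M.Obj) (η : ∀ s, M.Hom s (T s)), M.IsRepresentation T η →
          ∀ s : CartMulti.Ctx M.Obj, ∃ π : ∀ i, M.Hom (CartMulti.Ctx.single (T s)) (s.get i),
            (∀ i, M.post (π i) (η s) = φ.act (s.term i) (M.id (s.get i))) ∧
            Nonempty (IsLimit (Fan.mk (C := M.Underlying) (f := s.get) (T s) π))) ∧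
        ∃ _ : HasFiniteProducts M.Underlying,
          Nonempty ((⟨M, φ⟩ : CartMulti.FpMlt.{v, u}) ≅ CartMulti.timesObj ⟨M.Underlying⟩) := by
  refine ⟨CartMulti.times_isEquivalence, fun M hM => ⟨?_, fun φ => ⟨fun T η hR s => ?_, ?_⟩⟩⟩
  · obtain ⟨T, η, hR⟩ := hM
    exact CartMulti.FpStructure.subsingleton hR
  · obtain ⟨π, hπ⟩ := hR.exists_proj φ s
    exact ⟨π, hπ, ⟨(hR.isProd φ hπ).isLimit⟩⟩
  · have := CartMulti.hasFiniteProducts_underlying φ hM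
    exact ⟨this, CartMulti.nonempty_iso_timesObj φ hM⟩
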